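/- Let $G$ be a finite group, $p$ a prime, $F$ the field with $p$ elements and $\bar F$ an algebraic closure of $F$. All modules are finitely generated. For a subfield $K$ of $\bar F$ let $\mathrm{ITI}(KG)$ be the set of isomorphism types of indecomposable $KG$-modules; we do not distinguish between isomorphic modules, and $U\mid V$ means that $U$ is isomorphic to a direct summand of $V$. For $W\in\mathrm{ITI}(FG)$ let $\mathcal E(W)$ be the set of pairs $(K,V)$ such that $K$ is a finite subfield of $\bar F$, $V\in\mathrm{ITI}(KG)$ and $V\mid W\otimes_F K$. A vertex of an indecomposable $KG$-module $V$ is a minimal subgroup $Q$ of $G$ such that $V\mid \mathrm{Ind}_Q^G\mathrm{Res}^G_Q V$. A vertex-source pair of $V$ is a pair $(Q,\mathscr V)$ where $Q$ is a vertex of $V$ and $\mathscr V$ is an indecomposable $KQ$-module with $V\mid \mathrm{Ind}_Q^G\mathscr V$. If $Q$ is a vertex of $V$ and $H=N_G(Q)$, then the Green correspondent $\mathrm{Gr}_G^H(V)$ is the (unique up to isomorphism) indecomposable $KH$-module with vertex $Q$ that is isomorphic to a direct summand of $\mathrm{Res}^G_H V$. Then: (a) There is a well-defined map $\Gamma:\mathrm{ITI}(\bar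 FG)\to\mathrm{ITI}(FG)$ such that, for $Y\in \mathrm{ITI}(\bar FG)$ and $W\in\mathrm{ITI}(FG)$, one has $\Gamma(Y)=W$ if and only if there is a $(K,V)\in\mathcal E(W)$ with $V\otimes_K\bar F\cong Y$. Moreover, let $\Gamma(Y)=W$, let $(K,V)\in\mathcal E(W)$ be any pair with $V\otimes_K\bar F\cong Y$, let $Q$ be a vertex of $W$, and let $H=N_G(Q)$. Then $Q$ is a vertex of $V$ and of $Y$; if $(Q,\mathscr V)$ is a vertex-source pair of $V$ and $(Q,\mathscr Y)$ is a vertex-source pair of $Y$, then $\mathscr Y^h\mid\mathscr V\otimes_K\bar F$ as $\bar FQ$-modules for some $h\in H$; and the Green correspondents of $V$ and $Y$ exist and satisfy $\mathrm{Gr}_G^H(Y)\mid\mathrm{Gr}_G^H(V)\otimes_K\bar F$ as $\bar FH$-modules. (b) $\Gamma^{-1}(W)\neq\varnothing$ for all $W\in\mathrm{ITI}(FG)$. (c) $\mathrm{ITI}(\bar FG)=\bigcup_{W\in\mathrm{ITI}(FG)}\Gamma^{-1}(W)$ is a partition of $\mathrm{ITI}(\bar FG)$. -/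

import Mathlib

/-!
Finitely generated modules over a group algebra `KG` are modelled as finite-dimensional
representations of `G` over `K` (Mathlib's `Representation`). A right `KG`-module `V` corresponds
to the representation `ρ g v = v * g⁻¹`; this is an isomorphism of categories, compatible with
direct summands, restriction, induction, scalar extension and conjugation.
-/

open scoped TensorProduct

universe u v w w'

namespace GreenTheory

section Unbundled

variable {K : Type u} [Field K] {G : Type v} [Group G]
  {V : Type w} [AddCommGroup V] [Module K V]
  {W : Type w'} [AddCommGroup W] [Module K W]

/-- `V ∣ W`: the module `V` is isomorphic to a direct summand of the module `W`. -/
def IsSummand (ρ : Representation K G V) (σ : Representation K G W) : Prop :=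
  ∃ (i : ρ.IntertwiningMap σ) (r : σ.IntertwiningMap ρ),
    r.comp i = Representation.IntertwiningMap.id ρ

/-- A module is indecomposable if it is nonzero and it is not the direct sum of two nonzero
submodules. -/
def IsIndecomposable (ρ : Representation K G V) : Prop :=
  Nontrivial V ∧ ∀ A B : Subrepresentation ρ, IsCompl A B → A = ⊥ ∨ B = ⊥

/-- The restriction of a `KG`-module to a subgroup `R` of `G`. -/
def res (R : Subgroup G) (ρ : Representation K G V) : Representation K R V :=
  ρ.comp R.subtype

/-- The `KG`-module induced from a `KR`-module, for a subgroup `R` of `G`. -/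
noncomputable def ind (R : Subgroup G) (ρ : Representation K R V) :
    Representation K G (Representation.IndV R.subtype ρ) :=
  Representation.ind R.subtype ρ

/-- The extension of scalars of a `KG`-module to an extension `L` of the field `K`. -/
noncomputable def baseChange (L : Type*) [Field L] [Algebra K L] (ρ : Representation K G V) :
    Representation L G (L ⊗[K] V) where
  toFun g := (ρ g).baseChange L
  map_one' := by ext; simp
  map_mul' g h := by ext; simp

/-- The conjugate of a `KQ`-module by an element `h` of the normalizer `N_G(Q)`: the underlying
space is the same, and `q` acts as `h q h⁻¹` acted before. -/
def conj (Q : Subgroup G) (h : Subgroup.normalizer (Q : Set G)) (ρ : Representation K Q V) :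
    Representation K Q V :=
  ρ.comp (Q.normalizerMonoidHom h).toMonoidHom

/-- A `KG`-module `V` is `R`-projective, for a subgroup `R`, if it is isomorphic to a direct
summand of `Ind_R^G (Res_R^G V)`. -/
def IsRelProjective (R : Subgroup G) (ρ : Representation K G V) : Prop :=
  IsSummand ρ (ind R (res R ρ))

/-- `Q` is a vertex of `V`: `Q` is minimal among the subgroups `R` such that `V` is
`R`-projective. -/
def IsVertex (Q : Subgroup G) (ρ : Representation K G V) : Prop :=
  Minimal (fun R : Subgroup G => IsRelProjective R ρ) Q

end Unbundled

/-- Finitely generated indecomposable `KG`-modules. -/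
structure IndecModule (K : Type u) [Field K] (G : Type v) [Group G] where
  carrier : Type u
  [addCommGroup : AddCommGroup carrier]
  [module : Module K carrier]
  [finite : Module.Finite K carrier]
  ρ : Representation K G carrier
  indecomposable : IsIndecomposable ρ

attribute [instance] IndecModule.addCommGroup IndecModule.module IndecModule.finite

section Bundled

variable {K : Type u} [Field K] {G : Type v} [Group G]

/-- Isomorphism of `KG`-modules, as an equivalence relation. -/
instance indecSetoid (K : Type u) [Field K] (G : Type v) [Group G] :
    Setoid (IndecModule K G) where
  r V W := Nonempty (V.ρ.Equiv W.ρ)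
  iseqv :=
    { refl := fun V => ⟨Representation.Equiv.refl V.ρ⟩
      symm := fun ⟨e⟩ => ⟨e.symm⟩
      trans := fun ⟨e⟩ ⟨f⟩ => ⟨e.trans f⟩ }

/-- The set of isomorphism types of finitely generated indecomposable `KG`-modules. -/
def ITI (K : Type u) [Field K] (G : Type v) [Group G] : Type (max (u + 1) v) :=
  Quotient (indecSetoid K G)

/-- The isomorphism type of an indecomposable module. -/
def ITI.mk (V : IndecModule K G) : ITI K G := Quotient.mk (indecSetoid K G) V

/-- `(Q, S)` is a vertex-source pair of the indecomposable `KG`-module `V`: `Q` is a vertex of `V`,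
and `S` is an indecomposable `KQ`-module such that `V ∣ Ind_Q^G S`. -/
def IsVertexSourcePair (Q : Subgroup G) (S : IndecModule K Q) (V : IndecModule K G) : Prop :=
  IsVertex Q V.ρ ∧ IsSummand V.ρ (ind Q S.ρ)

/-- For an indecomposable `KG`-module `V` with vertex `Q` and for `H = N_G(Q)`, the
indecomposable `KH`-module `B` is (up to isomorphism) the Green correspondent `Gr_G^H(V)`: it has
vertex `Q`, and it is a component of `Res_H^G V`. -/
def IsGreenCorrespondent (Q : Subgroup G) (V : IndecModule K G)
    (B : IndecModule K (Subgroup.normalizer (Q : Set G))) : Prop :=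
  IsVertex Q V.ρ ∧
    IsVertex (Q.subgroupOf (Subgroup.normalizer (Q : Set G))) B.ρ ∧
      IsSummand B.ρ (res (Subgroup.normalizer (Q : Set G)) V.ρ)

/-- `(K, V) ↑ (L, U)`, for a field extension `L / K`: the indecomposable `LG`-module `U` is a
component of `V ⊗_K L`. -/
def Up {L : Type u} [Field L] [Algebra K L] (V : IndecModule K G) (U : IndecModule L G) : Prop :=
  IsSummand U.ρ (baseChange L V.ρ)

/-- The set `ℰ(W)` of all pairs `(K, V)` with `K` a finite subfield of `Φ` and `V` an
indecomposable `KG`-module such that `(F, W) ↑ (K, V)`. When `F` has prime order, every subfield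
of `Φ` contains the image of `F`, so the intermediate fields of `Φ / F` are all its subfields. -/
def E {F : Type u} [Field F] (Φ : Type u) [Field Φ] [Algebra F Φ] (W : IndecModule F G) :
    Set (Σ K : IntermediateField F Φ, IndecModule K G) :=
  {x | Finite x.1 ∧ Up W x.2}

end Bundled

end GreenTheory

/-! Everything rests on one fact about an indecomposable `KG`-module V and a field extension L/K.
The non-invertible endomorphisms of V lie in the radical of a finite-dimensional algebra, so their
L-span inside the endomorphisms of L ⊗ V is nilpotent (`isNilpotent_of_mem_span_baseChange`).
Intertwining maps between extended modules are L-combinations of extended maps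
(`mem_span_baseChange`). The projection to a nonzero summand Y of L ⊗ V is a nonzero idempotent,
hence outside that span; so whenever it is a combination of extended endomorphisms, one of these is
already invertible over K.

Two consequences follow. If Y divides both L ⊗ V and L ⊗ W, factoring the projection through L ⊗ W
gives V ∣ W (`isSummand_of_isSummand_baseChange`); this makes Γ single-valued. If Y is R-projective,
Higman's criterion turns the projection into a relative trace, and V is R-projective too; so V and Y
have the same vertices.

For the existence of Γ(Y): the matrices of Y have entries in a finite subfield K, and since K/F is
separable, a K-form of Y divides the extension of its own restriction to F. Some indecomposable
component of that `FG`-module still has Y in its extension.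

Sources and Green correspondents are handled by relative traces and Mackey's formula. Being a
summand of an induced module is a trace identity, and such identities survive scalar extension.
Hence Y divides Ind(L ⊗ S) for any source S of V, and conjugacy of sources applies. Likewise V
divides the module induced from its Green correspondent B, and every component of Res(L ⊗ V) with
vertex Q then divides L ⊗ B. -/

namespace GreenTheory

open Representation
open scoped Pointwise

/-! ### Intertwining maps, summands and Fitting's lemma. -/

section Local

variable {K : Type u} [Field K] {G : Type v} [Group G]
  {V : Type w} [AddCommGroup V] [Module K V] {ρ : Representation K G V}
  {W : Type w'} [AddCommGroup W] [Module K W] {σ : Representation K G W}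
  {U : Type*} [AddCommGroup U] [Module K U] {τ : Representation K G U}

theorem isIntertwiningMap_comp {f : W →ₗ[K] U} {g : V →ₗ[K] W} (hf : IsIntertwiningMap σ τ f)
    (hg : IsIntertwiningMap ρ σ g) : IsIntertwiningMap ρ τ (f ∘ₗ g) :=
  ⟨fun x v => by simp [hf.isIntertwining, hg.isIntertwining]⟩

theorem isIntertwiningMap_add {f g : V →ₗ[K] W} (hf : IsIntertwiningMap ρ σ f)
    (hg : IsIntertwiningMap ρ σ g) : IsIntertwiningMap ρ σ (f + g) :=
  ⟨fun x v => by simp [hf.isIntertwining, hg.isIntertwining]⟩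

theorem isIntertwiningMap_sum {ι : Type*} (s : Finset ι) {f : ι → V →ₗ[K] W}
    (hf : ∀ i ∈ s, IsIntertwiningMap ρ σ (f i)) : IsIntertwiningMap ρ σ (∑ i ∈ s, f i) :=
  ⟨fun x v => by
    simp only [LinearMap.sum_apply, map_sum]
    exact Finset.sum_congr rfl fun i hi => (hf i hi).isIntertwining x v⟩

theorem isIntertwiningMap_id : IsIntertwiningMap ρ ρ LinearMap.id := ⟨fun _ _ => rfl⟩

theorem isIntertwiningMap_of_intertwiningMap (f : ρ.IntertwiningMap σ) :
    IsIntertwiningMap ρ σ f.toLinearMap :=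
  ⟨fun g v => f.isIntertwining _ _ g v⟩

theorem isIntertwiningMap_symm {e : V ≃ₗ[K] W} (he : IsIntertwiningMap ρ σ e.toLinearMap) :
    IsIntertwiningMap σ ρ e.symm.toLinearMap :=
  ⟨fun g v => by
    have := he.isIntertwining g (e.symm v)
    simp only [LinearEquiv.coe_coe, LinearEquiv.apply_symm_apply] at this ⊢
    rw [← this, LinearEquiv.symm_apply_apply]⟩

/-- An intertwining map from its underlying linear map. -/
def toIntertwining {f : V →ₗ[K] W} (hf : IsIntertwiningMap ρ σ f) : ρ.IntertwiningMap σ :=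
  f.intertwiningMap_of_isIntertwiningMap ρ σ hf.isIntertwining

theorem isSummand_iff : IsSummand ρ σ ↔ ∃ (i : V →ₗ[K] W) (r : W →ₗ[K] V),
    IsIntertwiningMap ρ σ i ∧ IsIntertwiningMap σ ρ r ∧ r ∘ₗ i = LinearMap.id := by
  constructor
  · rintro ⟨i, r, h⟩
    exact ⟨i.toLinearMap, r.toLinearMap, isIntertwiningMap_of_intertwiningMap i,
      isIntertwiningMap_of_intertwiningMap r, congrArg (fun f => f.toLinearMap) h⟩
  · rintro ⟨i, r, hi, hr, h⟩
    exact ⟨toIntertwining hi, toIntertwining hr, IntertwiningMap.ext h⟩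

theorem IsSummand.trans (h : IsSummand ρ σ) (h' : IsSummand σ τ) : IsSummand ρ τ := by
  rw [isSummand_iff] at *
  obtain ⟨i, r, hi, hr, e⟩ := h
  obtain ⟨i', r', hi', hr', e'⟩ := h'
  refine ⟨i' ∘ₗ i, r ∘ₗ r', isIntertwiningMap_comp hi' hi, isIntertwiningMap_comp hr hr', ?_⟩
  rw [LinearMap.comp_assoc, ← LinearMap.comp_assoc i, e', LinearMap.id_comp, e]

theorem isSummand_of_equiv (e : ρ.Equiv σ) : IsSummand ρ σ :=
  ⟨e.toIntertwiningMap, e.symm.toIntertwiningMap, by ext v; exact e.symm_apply_apply v⟩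

theorem isSummand_of_bijective {α : V →ₗ[K] W} {β : W →ₗ[K] V} (hα : IsIntertwiningMap ρ σ α)
    (hβ : IsIntertwiningMap σ ρ β) (h : Function.Bijective (β ∘ₗ α)) : IsSummand ρ σ := by
  rw [isSummand_iff]
  let e := LinearEquiv.ofBijective (β ∘ₗ α) h
  have he : IsIntertwiningMap ρ ρ (β ∘ₗ α) := isIntertwiningMap_comp hβ hα
  have he' : IsIntertwiningMap ρ ρ e.symm.toLinearMap := isIntertwiningMap_symm (e := e) he
  refine ⟨α, e.symm.toLinearMap ∘ₗ β, hα, isIntertwiningMap_comp he' hβ, ?_⟩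
  ext v
  exact e.symm_apply_apply v

section Fitting

variable [FiniteDimensional K V] (hρ : IsIndecomposable ρ)
include hρ

theorem isNilpotent_or_bijective {f : V →ₗ[K] V} (hf : IsIntertwiningMap ρ ρ f) :
    IsNilpotent f ∨ Function.Bijective f := by
  have hpow : ∀ n : ℕ, IsIntertwiningMap ρ ρ (f ^ n) := by
    intro n
    induction n with
    | zero => exact isIntertwiningMap_id
    | succ n ih => rw [pow_succ]; exact isIntertwiningMap_comp ih hf
  obtain ⟨n, hn⟩ := Filter.eventually_atTop.mp (LinearMap.eventually_isCompl_ker_pow_range_pow f)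
  -- A positive exponent is needed so that injectivity of the power passes to `f`.
  have hc := hn (n + 1) (Nat.le_succ n)
  let F := toIntertwining (hpow (n + 1))
  have hcompl : IsCompl F.ker F.range := by
    constructor
    · rw [disjoint_iff]
      exact Subrepresentation.toSubmodule_injective hc.inf_eq_bot
    · rw [codisjoint_iff]
      exact Subrepresentation.toSubmodule_injective hc.sup_eq_top
  rcases hρ.2 _ _ hcompl with h | h
  · right
    have hk : LinearMap.ker (f ^ (n + 1)) = ⊥ := congrArg Subrepresentation.toSubmodule h
    have hinj : Function.Injective f := by
      have := LinearMap.ker_eq_bot.mp hk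
      rw [pow_succ] at this
      exact Function.Injective.of_comp this
    exact ⟨hinj, LinearMap.injective_iff_surjective.mp hinj⟩
  · left
    have hk : LinearMap.range (f ^ (n + 1)) = ⊥ := congrArg Subrepresentation.toSubmodule h
    exact ⟨n + 1, LinearMap.range_eq_bot.mp hk⟩

theorem bijective_or_bijective_of_add {f g : V →ₗ[K] V} (hf : IsIntertwiningMap ρ ρ f)
    (hg : IsIntertwiningMap ρ ρ g) (h : Function.Bijective (f + g : V →ₗ[K] V)) :
    Function.Bijective f ∨ Function.Bijective g := by
  let e := LinearEquiv.ofBijective (f + g) h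
  have he : IsIntertwiningMap ρ ρ e.symm.toLinearMap :=
    isIntertwiningMap_symm (e := e) (isIntertwiningMap_add hf hg)
  have hcancel : ∀ k : V →ₗ[K] V, Function.Bijective (k ∘ₗ e.symm.toLinearMap) →
      Function.Bijective k := fun k hk =>
    (Function.Bijective.of_comp_iff k e.symm.bijective).mp hk
  -- After composing with the inverse of `f + g` the two maps add up to 1, so if one is nilpotent
  -- the other is a unit.
  rcases isNilpotent_or_bijective hρ (isIntertwiningMap_comp hf he) with h1 | h1
  · right
    apply hcancel
    have h2 : g ∘ₗ e.symm.toLinearMap = 1 - f ∘ₗ e.symm.toLinearMap := by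
      ext v
      have := e.apply_symm_apply v
      simp only [LinearMap.comp_apply, LinearMap.sub_apply, Module.End.one_apply]
      rw [eq_sub_iff_add_eq', ← LinearMap.add_apply]
      exact this
    rw [h2]
    exact (Module.End.isUnit_iff _).mp h1.isUnit_one_sub
  · exact Or.inl (hcancel _ h1)

theorem exists_bijective_of_sum {ι : Type*} (s : Finset ι) {f : ι → V →ₗ[K] V}
    (hf : ∀ i ∈ s, IsIntertwiningMap ρ ρ (f i))
    (h : Function.Bijective (∑ i ∈ s, f i : V →ₗ[K] V)) :
    ∃ i ∈ s, Function.Bijective (f i) := by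
  classical
  have := hρ.1
  induction s using Finset.induction with
  | empty =>
    obtain ⟨v, hv⟩ := exists_ne (0 : V)
    rw [Finset.sum_empty] at h
    exact (hv (h.1 ((LinearMap.zero_apply v).trans (LinearMap.zero_apply 0).symm))).elim
  | insert a s ha ih =>
    rw [Finset.sum_insert ha] at h
    rcases bijective_or_bijective_of_add hρ (hf a (Finset.mem_insert_self a s))
      (isIntertwiningMap_sum s fun i hi => hf i (Finset.mem_insert_of_mem hi)) h with h | h
    · exact ⟨a, Finset.mem_insert_self a s, h⟩
    · obtain ⟨i, hi, h⟩ := ih (fun i hi => hf i (Finset.mem_insert_of_mem hi)) h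
      exact ⟨i, Finset.mem_insert_of_mem hi, h⟩

/-- The linear combinations of scalar extensions of non-invertible endomorphisms of an
indecomposable module are nilpotent. -/
theorem isNilpotent_of_mem_span_baseChange {L : Type*} [Field L] [Algebra K L]
    {x : Module.End L (L ⊗[K] V)}
    (hx : x ∈ Submodule.span L ((fun f : Module.End K V =>
      (f.baseChange L : Module.End L (L ⊗[K] V))) ''
      {f | IsIntertwiningMap ρ ρ f ∧ ¬ Function.Bijective f})) : IsNilpotent x := by
  set S : Set (Module.End K V) := {f | IsIntertwiningMap ρ ρ f ∧ ¬ Function.Bijective f}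
  let A : Subalgebra K (Module.End K V) := Subalgebra.centralizer K (Set.range ρ)
  have memA : ∀ f : Module.End K V, f ∈ A ↔ IsIntertwiningMap ρ ρ f := by
    intro f
    simp only [A, Subalgebra.mem_centralizer_iff, Set.forall_mem_range, isIntertwiningMap_iff]
    exact forall_congr' fun g => ⟨fun h v => (LinearMap.congr_fun h v).symm,
      fun h => LinearMap.ext fun v => (h v).symm⟩
  have hart : IsArtinianRing A := IsArtinianRing.of_finite K A
  -- If `f` were outside a maximal left ideal `m`, then `1 = a + b * f` with `a ∈ m`; but `b * f` is
  -- not bijective, hence nilpotent, and `a` would be a unit.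
  have hJ : ∀ f : A, ¬ Function.Bijective (f : Module.End K V) → f ∈ Ring.jacobson A := by
    intro f hf
    rw [Ring.jacobson_eq_sInf_isMaximal, Submodule.mem_sInf]
    intro (m : Ideal A) (hm : m.IsMaximal)
    by_contra hfm
    have h1 := (Ideal.isMaximal_iff.mp hm).2 (m ⊔ Ideal.span {f}) f le_sup_left hfm
      (Ideal.mem_sup_right (Ideal.mem_span_singleton_self f))
    obtain ⟨a, ha, c, hc, hac⟩ := Submodule.mem_sup.mp h1
    obtain ⟨b, rfl⟩ := Ideal.mem_span_singleton'.mp hc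
    have hbf : ¬ Function.Bijective (b * f : Module.End K V) := fun h =>
      hf (have hinj : Function.Injective (f : Module.End K V) := Function.Injective.of_comp h.1
        ⟨hinj, LinearMap.injective_iff_surjective.mp hinj⟩)
    obtain ⟨n, hn⟩ := (isNilpotent_or_bijective hρ ((memA _).mp (b * f).2)).resolve_right hbf
    have hnil : IsNilpotent (b * f) := ⟨n, Subtype.ext hn⟩
    have hu : IsUnit a := by
      rw [eq_sub_of_add_eq hac]
      exact hnil.isUnit_one_sub
    exact (Ideal.isMaximal_iff.mp hm).1 (Ideal.eq_top_of_isUnit_mem m ha hu ▸ Submodule.mem_top)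
  -- The exponent killing the radical over `K` also kills the span over `L`, because products of
  -- extended maps are extensions of products.
  obtain ⟨n, hn⟩ := (IsSemiprimaryRing.isNilpotent : IsNilpotent (Ring.jacobson A))
  have hpow : ∀ k : ℕ,
      ((fun f : Module.End K V => (f.baseChange L : Module.End L (L ⊗[K] V))) '' S) ^ k ⊆
      (fun f : A => ((f : Module.End K V).baseChange L : Module.End L (L ⊗[K] V))) ''
         ((Ring.jacobson A ^ k : Ideal A) : Set A) := by
    intro k
    induction k with
    | zero =>
      intro y hy
      rw [pow_zero, Set.mem_one] at hy
      exact ⟨1, by rw [Submodule.pow_zero, Ideal.one_eq_top]; trivial, hy ▸ LinearMap.baseChange_id⟩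
    | succ k ih =>
      rw [pow_succ]
      rintro _ ⟨y, hy, z, ⟨f, hf, rfl⟩, rfl⟩
      obtain ⟨g, hg, rfl⟩ := ih hy
      refine ⟨g * ⟨f, (memA f).mpr hf.1⟩, ?_, ?_⟩
      · rw [Submodule.pow_succ]
        exact Ideal.mul_mem_mul hg (hJ _ hf.2)
      · simp [LinearMap.baseChange_mul]
  refine ⟨n, ?_⟩
  have h1 := Submodule.pow_mem_pow _ hx n
  rw [Submodule.span_pow] at h1
  have h2 := Submodule.span_mono (hpow n) h1
  rw [hn] at h2
  simpa using h2

end Fitting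

end Local

/-! ### Selecting an indecomposable summand. -/

section Decomposition

variable {K : Type u} [Field K] {G : Type v} [Group G]
  {V : Type u} [AddCommGroup V] [Module K V] [FiniteDimensional K V]

/-- If a predicate on endomorphisms is additive in the weak sense that it holds for a summand of
every sum for which it holds, then it holds for the projection to an indecomposable summand as soon
as it holds for the identity. -/
theorem exists_indecomposable_summand (σ : Representation K G V) (p : (V →ₗ[K] V) → Prop)
    (h0 : ¬ p 0)
    (hadd : ∀ f g, IsIntertwiningMap σ σ f → IsIntertwiningMap σ σ g → p (f + g) → p f ∨ p g)
    (h1 : p LinearMap.id) :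
    ∃ (B : IndecModule K G) (i : B.carrier →ₗ[K] V) (r : V →ₗ[K] B.carrier),
      IsIntertwiningMap B.ρ σ i ∧ IsIntertwiningMap σ B.ρ r ∧ r ∘ₗ i = LinearMap.id ∧
        p (i ∘ₗ r) := by
  -- Induction on the dimension of a retract `M` of `V` whose projection satisfies `p`: a splitting
  -- of `M` writes this projection as a sum of two, and `p` holds for one of them.
  suffices H : ∀ (n : ℕ) (M : Type u) [AddCommGroup M] [Module K M] [FiniteDimensional K M]
      (τ : Representation K G M) (i : M →ₗ[K] V) (r : V →ₗ[K] M), Module.finrank K M = n →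
      IsIntertwiningMap τ σ i → IsIntertwiningMap σ τ r → r ∘ₗ i = LinearMap.id → p (i ∘ₗ r) →
      ∃ (B : IndecModule K G) (i : B.carrier →ₗ[K] V) (r : V →ₗ[K] B.carrier),
      IsIntertwiningMap B.ρ σ i ∧ IsIntertwiningMap σ B.ρ r ∧ r ∘ₗ i = LinearMap.id ∧
        p (i ∘ₗ r) from
    H _ V σ LinearMap.id LinearMap.id rfl isIntertwiningMap_id isIntertwiningMap_id rfl h1
  intro n
  induction n using Nat.strong_induction_on with
  | _ n ih =>
  intro M _ _ _ τ i r hn hi hr hri hp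
  by_cases hτ : IsIndecomposable τ
  · exact ⟨⟨M, τ, hτ⟩, i, r, hi, hr, hri, hp⟩
  have hM : Nontrivial M := by
    by_contra hM
    rw [not_nontrivial_iff_subsingleton] at hM
    apply h0
    convert hp
    ext v
    simp [Subsingleton.elim (r v) 0]
  simp only [IsIndecomposable, hM, true_and, not_forall, not_or] at hτ
  obtain ⟨A, B, hAB, hA, hB⟩ := hτ
  have hc : IsCompl A.toSubmodule B.toSubmodule :=
    ⟨disjoint_iff.mpr (congrArg Subrepresentation.toSubmodule hAB.inf_eq_bot),
      codisjoint_iff.mpr (congrArg Subrepresentation.toSubmodule hAB.sup_eq_top)⟩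
  have key : ∀ A B : Subrepresentation τ, B ≠ ⊥ → ∀ hc : IsCompl A.toSubmodule B.toSubmodule,
      Module.finrank K A.toSubmodule < n ∧
      IsIntertwiningMap A.toRepresentation τ A.toSubmodule.subtype ∧
      IsIntertwiningMap τ A.toRepresentation
        (Submodule.projectionOnto A.toSubmodule B.toSubmodule hc) := by
    intro A B hB hc
    refine ⟨?_, ⟨fun g v => rfl⟩, ⟨fun g v => ?_⟩⟩
    · rw [← hn]
      apply Submodule.finrank_lt
      rintro h
      rw [h] at hc
      exact hB (Subrepresentation.toSubmodule_injective (eq_bot_of_top_isCompl hc))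
    · obtain ⟨⟨a, b⟩, rfl, -⟩ := Submodule.existsUnique_add_of_isCompl_prod hc v
      have ha : τ g a = A.toRepresentation g a := rfl
      have hb : τ g b = B.toRepresentation g b := rfl
      simp only [map_add, ha, hb, Submodule.projectionOnto_apply_left,
        Submodule.projectionOnto_apply_right, add_zero]
  have hsum : i ∘ₗ r =
      (i ∘ₗ A.toSubmodule.subtype) ∘ₗ
        (Submodule.projectionOnto A.toSubmodule B.toSubmodule hc ∘ₗ r) +
      (i ∘ₗ B.toSubmodule.subtype) ∘ₗ
        (Submodule.projectionOnto B.toSubmodule A.toSubmodule hc.symm ∘ₗ r) := by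
    ext v
    have := Submodule.projection_add_projection_eq_self hc (r v)
    simp only [LinearMap.comp_apply, LinearMap.add_apply, ← map_add]
    congr 1
    exact this.symm
  have hret : ∀ A B : Subrepresentation τ, ∀ hc : IsCompl A.toSubmodule B.toSubmodule,
      (Submodule.projectionOnto A.toSubmodule B.toSubmodule hc ∘ₗ r) ∘ₗ
        (i ∘ₗ A.toSubmodule.subtype) = LinearMap.id := by
    intro A B hc
    rw [LinearMap.comp_assoc, ← LinearMap.comp_assoc _ i, hri, LinearMap.id_comp,
      Submodule.projectionOnto_comp_subtype]
  obtain ⟨a1, a2, a3⟩ := key A B hB hc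
  obtain ⟨b1, b2, b3⟩ := key B A hA hc.symm
  rw [hsum] at hp
  have ia := isIntertwiningMap_comp hi a2
  have ra := isIntertwiningMap_comp a3 hr
  have ib := isIntertwiningMap_comp hi b2
  have rb := isIntertwiningMap_comp b3 hr
  rcases hadd _ _ (isIntertwiningMap_comp ia ra) (isIntertwiningMap_comp ib rb) hp with h | h
  · exact ih _ a1 A.toSubmodule A.toRepresentation _ _ rfl ia ra (hret _ _ _) h
  · exact ih _ b1 B.toSubmodule B.toRepresentation _ _ rfl ib rb (hret _ _ _) h

end Decomposition

/-! ### Extension of scalars and descent of summands. -/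

section BaseChange

variable {K : Type u} [Field K] {L : Type*} [Field L] [Algebra K L] {G : Type v} [Group G]
  {V : Type w} [AddCommGroup V] [Module K V] {ρ : Representation K G V}
  {W : Type w'} [AddCommGroup W] [Module K W] {σ : Representation K G W}
  {U : Type*} [AddCommGroup U] [Module K U] {τ : Representation K G U}

theorem isIntertwiningMap_baseChange {f : V →ₗ[K] W} (hf : IsIntertwiningMap ρ σ f) :
    IsIntertwiningMap (baseChange L ρ) (baseChange L σ) (f.baseChange L) :=
  ⟨fun g v => by
    induction v with
    | zero => simp
    | add x y hx hy => simp only [map_add, hx, hy]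
    | tmul l v => simp [baseChange, hf.isIntertwining]⟩

theorem IsSummand.baseChange (h : IsSummand ρ σ) :
    IsSummand (baseChange L ρ) (baseChange L σ) := by
  rw [isSummand_iff] at *
  obtain ⟨i, r, hi, hr, e⟩ := h
  refine ⟨i.baseChange L, r.baseChange L, isIntertwiningMap_baseChange hi,
    isIntertwiningMap_baseChange hr, ?_⟩
  rw [← LinearMap.baseChange_comp, e, LinearMap.baseChange_id]

/-- Expand `φ (1 ⊗ v)` along a `K`-basis of `L`. Each coordinate is an intertwining map over `K`,
since `G` acts only on the factor `W`, and finitely many coordinates suffice since `V` is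
finite-dimensional. -/
theorem mem_span_baseChange [FiniteDimensional K V] {φ : L ⊗[K] V →ₗ[L] L ⊗[K] W}
    (hφ : IsIntertwiningMap (baseChange L ρ) (baseChange L σ) φ) :
    φ ∈ Submodule.span L ((fun f : V →ₗ[K] W => f.baseChange L) ''
      {f | IsIntertwiningMap ρ σ f}) := by
  classical
  let β := Module.Free.chooseBasis K L
  let b := Module.finBasis K V
  let T : Module.Free.ChooseBasisIndex K L → L ⊗[K] W →ₗ[K] W := fun j =>
    Finsupp.lapply j ∘ₗ (TensorProduct.equivFinsuppOfBasisLeft β).toLinearMap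
  have hT : ∀ j g z, T j (baseChange L σ g z) = σ g (T j z) := by
    intro j g z
    induction z with
    | zero => simp
    | add x y hx hy => simp only [map_add, hx, hy]
    | tmul l v => simp [T, baseChange]
  let ψ : Module.Free.ChooseBasisIndex K L → V →ₗ[K] W := fun j =>
    T j ∘ₗ φ.restrictScalars K ∘ₗ TensorProduct.mk K L V 1
  have hψ : ∀ j, IsIntertwiningMap ρ σ (ψ j) := by
    intro j
    refine ⟨fun g v => ?_⟩
    have := hφ.isIntertwining g (1 ⊗ₜ v)
    simp only [ψ, LinearMap.comp_apply, TensorProduct.mk_apply, LinearMap.restrictScalars_apply]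
    rw [← hT, ← this]
    rfl
  let J : Finset (Module.Free.ChooseBasisIndex K L) := Finset.univ.biUnion fun k =>
    (TensorProduct.equivFinsuppOfBasisLeft β (φ (1 ⊗ₜ b k))).support
  have hsum : φ = ∑ j ∈ J, β j • (ψ j).baseChange L := by
    refine (b.baseChange L).ext fun k => ?_
    rw [Module.Basis.baseChange_apply, LinearMap.sum_apply]
    simp only [LinearMap.smul_apply, LinearMap.baseChange_tmul, TensorProduct.smul_tmul',
      smul_eq_mul, mul_one]
    conv_lhs => rw [← (TensorProduct.equivFinsuppOfBasisLeft β).symm_apply_apply (φ (1 ⊗ₜ b k))]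
    rw [TensorProduct.equivFinsuppOfBasisLeft_symm_apply]
    refine Finsupp.sum_of_support_subset _ ?_ _ (by simp)
    exact Finset.subset_biUnion_of_mem
      (fun k => (TensorProduct.equivFinsuppOfBasisLeft β (φ (1 ⊗ₜ b k))).support)
      (Finset.mem_univ k)
  rw [hsum]
  exact Submodule.sum_mem _ fun j _ =>
    Submodule.smul_mem _ _ (Submodule.subset_span ⟨ψ j, hψ j, rfl⟩)

theorem comp_mem_span_baseChange {A : Set (V →ₗ[K] W)} {B : Set (W →ₗ[K] U)} {C : Set (V →ₗ[K] U)}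
    (hABC : ∀ a ∈ A, ∀ b ∈ B, b ∘ₗ a ∈ C) {x : L ⊗[K] V →ₗ[L] L ⊗[K] W}
    {y : L ⊗[K] W →ₗ[L] L ⊗[K] U}
    (hx : x ∈ Submodule.span L ((fun f : V →ₗ[K] W => f.baseChange L) '' A))
    (hy : y ∈ Submodule.span L ((fun f : W →ₗ[K] U => f.baseChange L) '' B)) :
    y ∘ₗ x ∈ Submodule.span L ((fun f : V →ₗ[K] U => f.baseChange L) '' C) := by
  induction hx using Submodule.span_induction with
  | zero => simp
  | add a a' _ _ h h' => rw [LinearMap.comp_add]; exact Submodule.add_mem _ h h'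
  | smul c a _ h => rw [LinearMap.comp_smul]; exact Submodule.smul_mem _ _ h
  | mem a ha =>
    obtain ⟨a, ha, rfl⟩ := ha
    induction hy using Submodule.span_induction with
    | zero => simp
    | add b b' _ _ h h' => rw [LinearMap.add_comp]; exact Submodule.add_mem _ h h'
    | smul c b _ h => rw [LinearMap.smul_comp]; exact Submodule.smul_mem _ _ h
    | mem b hb =>
      obtain ⟨b, hb, rfl⟩ := hb
      exact Submodule.subset_span ⟨b ∘ₗ a, hABC a ha b hb, LinearMap.baseChange_comp _ _⟩

variable {Y : Type*} [AddCommGroup Y] [Module L Y] {υ : Representation L G Y}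

/-- The projection to a nonzero summand of the scalar extension of an indecomposable module is
not a combination of scalar extensions of non-invertible endomorphisms. -/
theorem comp_notMem_span_baseChange [FiniteDimensional K V] (hρ : IsIndecomposable ρ)
    [Nontrivial Y] {i : Y →ₗ[L] L ⊗[K] V} {r : L ⊗[K] V →ₗ[L] Y} (hri : r ∘ₗ i = LinearMap.id) :
    i ∘ₗ r ∉ Submodule.span L ((fun f : V →ₗ[K] V => f.baseChange L) ''
      {f | IsIntertwiningMap ρ ρ f ∧ ¬ Function.Bijective f}) := by
  intro h
  obtain ⟨n, hn⟩ := isNilpotent_of_mem_span_baseChange hρ h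
  -- Nilpotence of the idempotent `i ∘ r` would force `i = 0`, although `r ∘ i` is the identity of a
  -- nonzero space.
  have hpow : ∀ n : ℕ, ((i ∘ₗ r : Module.End L (L ⊗[K] V)) ^ n) ∘ₗ i = i := by
    intro n
    induction n with
    | zero => rfl
    | succ n ih =>
      rw [pow_succ, Module.End.mul_eq_comp, LinearMap.comp_assoc, LinearMap.comp_assoc, hri,
        LinearMap.comp_id, ih]
  have hi := hpow n
  rw [hn, LinearMap.zero_comp] at hi
  rw [← hi, LinearMap.comp_zero] at hri
  obtain ⟨y, hy⟩ := exists_ne (0 : Y)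
  exact hy (LinearMap.congr_fun hri y).symm

/-- If the scalar extensions of `V` and `W` have a nonzero common summand and `V` is
indecomposable, then `V ∣ W`. -/
theorem isSummand_of_isSummand_baseChange [FiniteDimensional K V] [FiniteDimensional K W]
    (hρ : IsIndecomposable ρ) [Nontrivial Y] (hV : IsSummand υ (GreenTheory.baseChange L ρ))
    (hW : IsSummand υ (GreenTheory.baseChange L σ)) : IsSummand ρ σ := by
  by_contra hcon
  rw [isSummand_iff] at hV hW
  obtain ⟨i, r, hi, hr, e⟩ := hV
  obtain ⟨i', r', hi', hr', e'⟩ := hW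
  -- With this retraction the projection reads `(i ∘ r') ∘ (i' ∘ r)` and passes through `L ⊗ W`. If
  -- no composite `V → W → V` were bijective, it would lie in the forbidden span.
  have hretr : (r' ∘ₗ i' ∘ₗ r) ∘ₗ i = LinearMap.id := by
    rw [← LinearMap.comp_assoc, e', LinearMap.id_comp, e]
  apply comp_notMem_span_baseChange hρ hretr
  have h1 := mem_span_baseChange (isIntertwiningMap_comp hi' hr)
  have h2 := mem_span_baseChange (isIntertwiningMap_comp hi hr')
  refine comp_mem_span_baseChange (fun a ha b hb => ?_) h1 h2
  exact ⟨isIntertwiningMap_comp hb ha, fun h => hcon (isSummand_of_bijective ha hb h)⟩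

end BaseChange

theorem sum_linearMap_comp {K V W U ι : Type*} [Field K] [AddCommGroup V] [Module K V]
    [AddCommGroup W] [Module K W] [AddCommGroup U] [Module K U] (s : Finset ι)
    (f : ι → W →ₗ[K] U) (g : V →ₗ[K] W) : (∑ i ∈ s, f i) ∘ₗ g = ∑ i ∈ s, f i ∘ₗ g := by
  ext v
  simp

theorem linearMap_comp_sum {K V W U ι : Type*} [Field K] [AddCommGroup V] [Module K V]
    [AddCommGroup W] [Module K W] [AddCommGroup U] [Module K U] (s : Finset ι)
    (f : ι → V →ₗ[K] W) (g : W →ₗ[K] U) : g ∘ₗ (∑ i ∈ s, f i) = ∑ i ∈ s, g ∘ₗ f i := by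
  ext v
  simp

/-! ### Relative traces. -/

section Trace

variable {K : Type u} [Field K] {G : Type v} [Group G] [Finite G]
  {V : Type w} [AddCommGroup V] [Module K V]
  {W : Type w'} [AddCommGroup W] [Module K W]

/-- The relative trace `∑ g f g⁻¹`, the sum over representatives `g` of the cosets of `R`. -/
noncomputable def relTrace (R : Subgroup G) (ρ : Representation K G V) (σ : Representation K G W)
    (f : V →ₗ[K] W) : V →ₗ[K] W :=
  letI := Fintype.ofFinite (G ⧸ R)
  ∑ q : G ⧸ R, σ q.out ∘ₗ f ∘ₗ ρ q.out⁻¹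

theorem relTrace_eq_sum (R : Subgroup G) [Fintype (G ⧸ R)] (ρ : Representation K G V)
    (σ : Representation K G W) (f : V →ₗ[K] W) :
    relTrace R ρ σ f = ∑ q : G ⧸ R, σ q.out ∘ₗ f ∘ₗ ρ q.out⁻¹ := by
  rw [relTrace]
  congr!

variable {R : Subgroup G} {ρ : Representation K G V} {σ : Representation K G W}

omit [Finite G] in
theorem conj_eq_of_mk_eq {f : V →ₗ[K] W} (hf : IsIntertwiningMap (res R ρ) (res R σ) f) {g h : G}
    (hgh : (g : G ⧸ R) = h) : σ g ∘ₗ f ∘ₗ ρ g⁻¹ = σ h ∘ₗ f ∘ₗ ρ h⁻¹ := by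
  rw [QuotientGroup.eq] at hgh
  ext v
  have h1 := hf.isIntertwining ⟨_, hgh⟩ (ρ h⁻¹ v)
  simp only [res, MonoidHom.comp_apply, Subgroup.subtype_apply, ← Module.End.mul_apply,
    ← map_mul, mul_assoc, mul_inv_cancel, mul_one] at h1
  simp only [LinearMap.comp_apply, h1, ← Module.End.mul_apply, ← map_mul, mul_inv_cancel_left]

/-- The terms of the relative trace, as a function on the cosets. -/
noncomputable def traceTerm (R : Subgroup G) (ρ : Representation K G V) (σ : Representation K G W)
    (f : V →ₗ[K] W) (q : G ⧸ R) : V →ₗ[K] W := σ q.out ∘ₗ f ∘ₗ ρ q.out⁻¹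

omit [Finite G] in
theorem traceTerm_mk {f : V →ₗ[K] W} (hf : IsIntertwiningMap (res R ρ) (res R σ) f) (g : G) :
    traceTerm R ρ σ f (g : G ⧸ R) = σ g ∘ₗ f ∘ₗ ρ g⁻¹ :=
  conj_eq_of_mk_eq hf (QuotientGroup.out_eq' _)

theorem relTrace_eq_sum_traceTerm (R : Subgroup G) [Fintype (G ⧸ R)] (ρ : Representation K G V)
    (σ : Representation K G W) (f : V →ₗ[K] W) :
    relTrace R ρ σ f = ∑ q : G ⧸ R, traceTerm R ρ σ f q := relTrace_eq_sum _ _ _ _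

omit [Finite G] in
theorem traceTerm_smul {f : V →ₗ[K] W} (hf : IsIntertwiningMap (res R ρ) (res R σ) f) (g : G)
    (q : G ⧸ R) : traceTerm R ρ σ f (g • q) = σ g ∘ₗ traceTerm R ρ σ f q ∘ₗ ρ g⁻¹ := by
  induction q using QuotientGroup.induction_on with
  | H x =>
    have : g • (x : G ⧸ R) = ((g * x : G) : G ⧸ R) := rfl
    rw [this, traceTerm_mk hf, traceTerm_mk hf]
    ext v
    simp only [LinearMap.comp_apply, mul_inv_rev, map_mul, Module.End.mul_apply]

theorem isIntertwiningMap_relTrace {f : V →ₗ[K] W}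
    (hf : IsIntertwiningMap (res R ρ) (res R σ) f) : IsIntertwiningMap ρ σ (relTrace R ρ σ f) := by
  let _ := Fintype.ofFinite (G ⧸ R)
  refine ⟨fun g v => ?_⟩
  have h1 : relTrace R ρ σ f = σ g ∘ₗ relTrace R ρ σ f ∘ₗ ρ g⁻¹ := by
    rw [relTrace_eq_sum_traceTerm]
    conv_lhs => rw [← Equiv.sum_comp (MulAction.toPerm g)]
    simp only [MulAction.toPerm_apply, traceTerm_smul hf, sum_linearMap_comp, linearMap_comp_sum]
  conv_lhs => rw [h1]
  simp only [LinearMap.comp_apply, ← Module.End.mul_apply, ← map_mul, inv_mul_cancel, map_one,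
    Module.End.one_apply]

theorem relTrace_add (f g : V →ₗ[K] W) :
    relTrace R ρ σ (f + g) = relTrace R ρ σ f + relTrace R ρ σ g := by
  let _ := Fintype.ofFinite (G ⧸ R)
  simp only [relTrace_eq_sum, LinearMap.add_comp, LinearMap.comp_add, Finset.sum_add_distrib]

theorem relTrace_zero : relTrace R ρ σ 0 = 0 := by
  let _ := Fintype.ofFinite (G ⧸ R)
  simp [relTrace_eq_sum]

theorem relTrace_sum {ι : Type*} (s : Finset ι) (f : ι → V →ₗ[K] W) :
    relTrace R ρ σ (∑ i ∈ s, f i) = ∑ i ∈ s, relTrace R ρ σ (f i) := by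
  let _ := Fintype.ofFinite (G ⧸ R)
  simp only [relTrace_eq_sum, sum_linearMap_comp, linearMap_comp_sum]
  exact Finset.sum_comm

theorem relTrace_smul (c : K) (f : V →ₗ[K] W) :
    relTrace R ρ σ (c • f) = c • relTrace R ρ σ f := by
  let _ := Fintype.ofFinite (G ⧸ R)
  simp only [relTrace_eq_sum, LinearMap.smul_comp, LinearMap.comp_smul, Finset.smul_sum]

variable {V' : Type*} [AddCommGroup V'] [Module K V'] {ρ' : Representation K G V'}
  {W' : Type*} [AddCommGroup W'] [Module K W'] {σ' : Representation K G W'}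

theorem comp_relTrace {β : W →ₗ[K] W'} (hβ : IsIntertwiningMap σ σ' β) (f : V →ₗ[K] W) :
    β ∘ₗ relTrace R ρ σ f = relTrace R ρ σ' (β ∘ₗ f) := by
  let _ := Fintype.ofFinite (G ⧸ R)
  simp only [relTrace_eq_sum, linearMap_comp_sum]
  refine Finset.sum_congr rfl fun q _ => ?_
  ext v
  simp [hβ.isIntertwining]

theorem relTrace_comp {α : V' →ₗ[K] V} (hα : IsIntertwiningMap ρ' ρ α) (f : V →ₗ[K] W) :
    relTrace R ρ σ f ∘ₗ α = relTrace R ρ' σ (f ∘ₗ α) := by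
  let _ := Fintype.ofFinite (G ⧸ R)
  simp only [relTrace_eq_sum, sum_linearMap_comp]
  refine Finset.sum_congr rfl fun q _ => ?_
  ext v
  simp [hα.isIntertwining]

theorem relTrace_baseChange {L : Type*} [Field L] [Algebra K L] (f : V →ₗ[K] W) :
    relTrace R (baseChange L ρ) (baseChange L σ) (f.baseChange L) =
      (relTrace R ρ σ f).baseChange L := by
  let _ := Fintype.ofFinite (G ⧸ R)
  simp only [relTrace_eq_sum]
  ext v
  simp [baseChange, TensorProduct.tmul_sum]

theorem relTrace_top {f : V →ₗ[K] W} (hf : IsIntertwiningMap ρ σ f) : relTrace ⊤ ρ σ f = f := by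
  let _ := Fintype.ofFinite (G ⧸ (⊤ : Subgroup G))
  have : Unique (G ⧸ (⊤ : Subgroup G)) :=
    { default := ((1 : G) : G ⧸ (⊤ : Subgroup G))
      uniq := fun _ => QuotientGroup.subsingleton_quotient_top.elim _ _ }
  rw [relTrace_eq_sum, Fintype.sum_unique]
  ext v
  simp only [LinearMap.comp_apply, ← hf.isIntertwining, ← Module.End.mul_apply, ← map_mul,
    mul_inv_cancel, map_one, Module.End.one_apply]

/-- Products of representatives for G/Q and Q/P represent the cosets of P in G, and a term of the
trace depends only on its coset. -/
theorem relTrace_relTrace {Q : Subgroup G} {P : Subgroup Q} {f : V →ₗ[K] W}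
    (hf : IsIntertwiningMap (res P (res Q ρ)) (res P (res Q σ)) f) :
    relTrace Q ρ σ (relTrace P (res Q ρ) (res Q σ) f) = relTrace (P.map Q.subtype) ρ σ f := by
  obtain ⟨R, hR⟩ : ∃ R, R = P.map Q.subtype := ⟨_, rfl⟩
  have hRQ : R ≤ Q := hR ▸ Subgroup.map_subtype_le P
  have hP : R.subgroupOf Q = P := by
    rw [hR, Subgroup.subgroupOf, Subgroup.comap_map_eq_self_of_injective Q.subtype_injective]
  have hfR : IsIntertwiningMap (res R ρ) (res R σ) f := by
    refine ⟨fun g v => ?_⟩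
    have hg : (⟨g, hRQ g.2⟩ : Q) ∈ P := by rw [← hP]; exact g.2
    exact hf.isIntertwining ⟨_, hg⟩ v
  rw [← hR]
  subst hP
  let _ := Fintype.ofFinite (G ⧸ Q)
  let _ := Fintype.ofFinite (G ⧸ R)
  let _ := Fintype.ofFinite (Q ⧸ R.subgroupOf Q)
  rw [relTrace_eq_sum_traceTerm R, ← Equiv.sum_comp (Subgroup.quotientEquivProdOfLE hRQ).symm,
    Fintype.sum_prod_type, relTrace_eq_sum Q]
  refine Finset.sum_congr rfl fun q _ => ?_
  rw [relTrace_eq_sum_traceTerm, sum_linearMap_comp, linearMap_comp_sum]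
  refine Finset.sum_congr rfl fun x _ => ?_
  induction x using QuotientGroup.induction_on with
  | H x =>
    have h1 : (Subgroup.quotientEquivProdOfLE hRQ).symm (q, (x : Q ⧸ R.subgroupOf Q)) =
        ((q.out * x : G) : G ⧸ R) := rfl
    rw [h1, traceTerm_mk hfR, traceTerm_mk hf]
    ext v
    simp [res]

end Trace

/-! ### Mackey's formula. -/

section Mackey

variable {K : Type u} [Field K] {G : Type v} [Group G] [Finite G] {S : Type*} [Group S] [Finite S]
  {V : Type w} [AddCommGroup V] [Module K V] {ρ : Representation K G V}
  {W : Type w'} [AddCommGroup W] [Module K W] {σ : Representation K G W}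
  {R : Subgroup G}

/-- The composite of a homomorphism with the conjugation `x ↦ g⁻¹ x g`. -/
def twist (φ : S →* G) (g : G) : S →* G := (MulAut.conj g⁻¹).toMonoidHom.comp φ

omit [Finite G] [Finite S] in
theorem mem_comap_twist {φ : S →* G} {g : G} {s : S} :
    s ∈ R.comap (twist φ g) ↔ g⁻¹ * φ s * g ∈ R := by
  simp [twist]

omit [Finite G] [Finite S] in
theorem isIntertwiningMap_conj_twist {f : V →ₗ[K] W}
    (hf : IsIntertwiningMap (res R ρ) (res R σ) f) (φ : S →* G) (g : G) :
    IsIntertwiningMap (res (R.comap (twist φ g)) (ρ.comp φ))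
      (res (R.comap (twist φ g)) (σ.comp φ)) (σ g ∘ₗ f ∘ₗ ρ g⁻¹) := by
  refine ⟨fun s v => ?_⟩
  have h1 := hf.isIntertwining ⟨_, mem_comap_twist.mp s.2⟩ (ρ g⁻¹ v)
  simp only [res, MonoidHom.comp_apply, Subgroup.subtype_apply, ← Module.End.mul_apply,
    ← map_mul, mul_assoc, mul_inv_cancel, mul_one] at h1
  simp only [res, MonoidHom.comp_apply, Subgroup.subtype_apply, LinearMap.comp_apply,
    ← Module.End.mul_apply, ← map_mul, h1, mul_inv_cancel_left]

/-- Mackey's formula for relative traces. -/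
theorem exists_relTrace_eq_sum (R : Subgroup G) (φ : S →* G) :
    ∃ (ι : Type v) (_ : Fintype ι) (g : ι → G), (∀ i, g i ∈ φ.range → g i = 1) ∧
      ∀ {V : Type w} [AddCommGroup V] [Module K V] {W : Type w'} [AddCommGroup W] [Module K W]
        (ρ : Representation K G V) (σ : Representation K G W) (f : V →ₗ[K] W),
        IsIntertwiningMap (res R ρ) (res R σ) f →
        relTrace R ρ σ f = ∑ i, relTrace (R.comap (twist φ (g i))) (ρ.comp φ) (σ.comp φ)
          (σ (g i) ∘ₗ f ∘ₗ ρ (g i)⁻¹) := by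
  classical
  let _ : MulAction S (G ⧸ R) := MulAction.compHom (G ⧸ R) φ
  let _ := Fintype.ofFinite (G ⧸ R)
  let _ : Fintype (MulAction.orbitRel.Quotient S (G ⧸ R)) := Fintype.ofFinite _
  -- The double coset meeting the image of `φ` is represented by 1. Later, showing that a
  -- representative lies in a subgroup is then enough to conclude that it is 1.
  have hout : ∀ ω : MulAction.orbitRel.Quotient S (G ⧸ R), ∃ g : G,
      (Quotient.mk _ (g : G ⧸ R) : MulAction.orbitRel.Quotient S (G ⧸ R)) = ω ∧
        (g ∈ φ.range → g = 1) := by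
    intro ω
    induction ω using Quotient.inductionOn with
    | h q =>
    induction q using QuotientGroup.induction_on with
    | H x =>
    by_cases h : ∃ s : S, (Quotient.mk _ ((φ s : G) : G ⧸ R) :
        MulAction.orbitRel.Quotient S (G ⧸ R)) = Quotient.mk _ (x : G ⧸ R)
    · obtain ⟨s, hs⟩ := h
      refine ⟨1, ?_, fun _ => rfl⟩
      rw [← hs]
      refine Quotient.sound ?_
      refine ⟨s⁻¹, ?_⟩
      change ((φ s⁻¹ * φ s : G) : G ⧸ R) = ((1 : G) : G ⧸ R)
      rw [← map_mul, inv_mul_cancel, map_one]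
    · refine ⟨x, rfl, ?_⟩
      rintro ⟨s, rfl⟩
      exact absurd ⟨s, rfl⟩ h
  choose g hg hg1 using hout
  refine ⟨_, inferInstance, g, hg1, ?_⟩
  intro V _ _ W _ _ ρ σ f hf
  have hinv : Function.LeftInverse Quotient.mk'' fun ω => ((g ω : G) : G ⧸ R) := hg
  let e : G ⧸ R ≃ Σ ω : MulAction.orbitRel.Quotient S (G ⧸ R),
      S ⧸ MulAction.stabilizer S ((g ω : G) : G ⧸ R) :=
    MulAction.selfEquivSigmaOrbitsQuotientStabilizer' S (G ⧸ R) hinv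
  let _ : ∀ ω : MulAction.orbitRel.Quotient S (G ⧸ R),
    Fintype (S ⧸ MulAction.stabilizer S ((g ω : G) : G ⧸ R)) := fun _ => Fintype.ofFinite _
  rw [relTrace_eq_sum_traceTerm, ← Equiv.sum_comp e.symm, Fintype.sum_sigma]
  refine Finset.sum_congr rfl fun ω _ => ?_
  have hstab : MulAction.stabilizer S ((g ω : G) : G ⧸ R) = R.comap (twist φ (g ω)) := by
    ext s
    rw [MulAction.mem_stabilizer_iff, mem_comap_twist]
    change ((φ s * g ω : G) : G ⧸ R) = (g ω : G ⧸ R) ↔ _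
    rw [eq_comm, QuotientGroup.eq, mul_assoc]
  have hf' := isIntertwiningMap_conj_twist hf φ (g ω)
  rw [← hstab] at hf' ⊢
  rw [relTrace_eq_sum_traceTerm]
  refine Finset.sum_congr rfl fun x _ => ?_
  induction x using QuotientGroup.induction_on with
  | H s =>
    have h1 : e.symm ⟨ω, (s : S ⧸ MulAction.stabilizer S ((g ω : G) : G ⧸ R))⟩ =
        ((φ s * g ω : G) : G ⧸ R) := rfl
    rw [h1, traceTerm_mk hf, traceTerm_mk hf']
    ext v
    simp

end Mackey

/-! ### Higman's criterion and its behaviour under scalar extension. -/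

section RelProjective

variable {K : Type u} [Field K] {G : Type v} [Group G] [Finite G]
  {V : Type w} [AddCommGroup V] [Module K V] {ρ : Representation K G V}
  {W : Type w'} [AddCommGroup W] [Module K W] {σ : Representation K G W}
  {R : Subgroup G}

/-- Higman's criterion: the identity is a relative trace. -/
def HasTrace (R : Subgroup G) (ρ : Representation K G V) : Prop :=
  ∃ f : V →ₗ[K] V, IsIntertwiningMap (res R ρ) (res R ρ) f ∧ relTrace R ρ ρ f = LinearMap.id

omit [Finite G] in
theorem isIntertwiningMap_res {f : V →ₗ[K] W} (hf : IsIntertwiningMap ρ σ f) (R : Subgroup G) :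
    IsIntertwiningMap (res R ρ) (res R σ) f :=
  ⟨fun g v => hf.isIntertwining g v⟩

/-- The inverse of an invertible trace commutes with `G`, so it can be moved inside the trace. -/
theorem hasTrace_of_bijective {f : V →ₗ[K] V} (hf : IsIntertwiningMap (res R ρ) (res R ρ) f)
    (h : Function.Bijective (relTrace R ρ ρ f)) : HasTrace R ρ := by
  let e := LinearEquiv.ofBijective (relTrace R ρ ρ f) h
  have he : IsIntertwiningMap ρ ρ e.symm.toLinearMap :=
    isIntertwiningMap_symm (e := e) (isIntertwiningMap_relTrace hf)
  refine ⟨f ∘ₗ e.symm.toLinearMap, isIntertwiningMap_comp hf (isIntertwiningMap_res he R), ?_⟩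
  rw [← relTrace_comp he]
  ext v
  exact e.apply_symm_apply v

theorem HasTrace.of_isSummand (hσ : HasTrace R σ) (h : IsSummand ρ σ) : HasTrace R ρ := by
  obtain ⟨f, hf, hid⟩ := hσ
  obtain ⟨i, r, hi, hr, e⟩ := isSummand_iff.mp h
  refine ⟨r ∘ₗ f ∘ₗ i, isIntertwiningMap_comp (isIntertwiningMap_res hr R)
    (isIntertwiningMap_comp hf (isIntertwiningMap_res hi R)), ?_⟩
  rw [← comp_relTrace hr, ← relTrace_comp hi, hid, LinearMap.id_comp, e]

variable {L : Type*} [Field L] [Algebra K L] {Y : Type*} [AddCommGroup Y] [Module L Y]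
  {υ : Representation L G Y}

omit [Finite G] in
theorem isIntertwiningMap_res_baseChange {f : V →ₗ[K] W}
    (hf : IsIntertwiningMap (res R ρ) (res R σ) f) :
    IsIntertwiningMap (res R (baseChange L ρ)) (res R (baseChange L σ)) (f.baseChange L) :=
  ⟨fun g v => (isIntertwiningMap_baseChange hf).isIntertwining g v⟩

theorem HasTrace.baseChange (h : HasTrace R ρ) : HasTrace R (baseChange L ρ) := by
  obtain ⟨f, hf, hid⟩ := h
  exact ⟨f.baseChange L, isIntertwiningMap_res_baseChange hf, by
    rw [relTrace_baseChange, hid, LinearMap.baseChange_id]⟩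

/-- The projection onto Y is the trace of an `L`-combination of extended `R`-maps, and traces
commute with extension. If no trace from `R` over `K` were invertible, the projection would lie in
the forbidden span. -/
theorem HasTrace.of_baseChange [FiniteDimensional K V] (hρ : IsIndecomposable ρ) [Nontrivial Y]
    (hY : IsSummand υ (GreenTheory.baseChange L ρ)) (h : HasTrace R υ) : HasTrace R ρ := by
  by_contra hcon
  obtain ⟨f, hf, hid⟩ := h
  obtain ⟨i, r, hi, hr, e⟩ := isSummand_iff.mp hY
  apply comp_notMem_span_baseChange hρ e
  have h1 : i ∘ₗ r = relTrace R (GreenTheory.baseChange L ρ) (GreenTheory.baseChange L ρ)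
      (i ∘ₗ f ∘ₗ r) := by
    rw [← comp_relTrace hi, ← relTrace_comp hr, hid, LinearMap.id_comp]
  have h2 : IsIntertwiningMap (res R (GreenTheory.baseChange L ρ))
      (res R (GreenTheory.baseChange L ρ)) (i ∘ₗ f ∘ₗ r) :=
    isIntertwiningMap_comp (isIntertwiningMap_res hi R)
      (isIntertwiningMap_comp hf (isIntertwiningMap_res hr R))
  have h3 : i ∘ₗ f ∘ₗ r ∈ Submodule.span L ((fun f : V →ₗ[K] V => f.baseChange L) ''
      {f | IsIntertwiningMap (res R ρ) (res R ρ) f}) :=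
    mem_span_baseChange ⟨fun g v => h2.isIntertwining g v⟩
  rw [h1]
  generalize i ∘ₗ f ∘ₗ r = x at h3
  induction h3 using Submodule.span_induction with
  | zero => rw [relTrace_zero]; exact Submodule.zero_mem _
  | add a b _ _ ha hb => rw [relTrace_add]; exact Submodule.add_mem _ ha hb
  | smul c a _ ha => rw [relTrace_smul]; exact Submodule.smul_mem _ _ ha
  | mem a ha =>
    obtain ⟨a, ha, rfl⟩ := ha
    dsimp only
    rw [relTrace_baseChange]
    refine Submodule.subset_span ⟨_, ⟨isIntertwiningMap_relTrace ha, fun hb => hcon ?_⟩, rfl⟩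
    exact hasTrace_of_bijective ha hb

theorem hasTrace_iff_of_isSummand_baseChange [FiniteDimensional K V] (hρ : IsIndecomposable ρ)
    [Nontrivial Y] (hY : IsSummand υ (GreenTheory.baseChange L ρ)) :
    HasTrace R υ ↔ HasTrace R ρ :=
  ⟨HasTrace.of_baseChange hρ hY, fun h => h.baseChange.of_isSummand hY⟩

/-- Transitivity of traces. It lets the minimality of a vertex in `G` bound the vertices of a module
over a subgroup. -/
theorem HasTrace.trans {Q : Subgroup G} {P : Subgroup Q}
    {X : Type*} [AddCommGroup X] [Module K X] {τ : Representation K Q X} (h : HasTrace P τ)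
    {a : V →ₗ[K] X} {b : X →ₗ[K] V} (ha : IsIntertwiningMap (res Q ρ) τ a)
    (hb : IsIntertwiningMap τ (res Q ρ) b) (hab : relTrace Q ρ ρ (b ∘ₗ a) = LinearMap.id) :
    HasTrace (P.map Q.subtype) ρ := by
  obtain ⟨f, hf, hid⟩ := h
  have hf' : IsIntertwiningMap (res P (res Q ρ)) (res P (res Q ρ)) (b ∘ₗ f ∘ₗ a) :=
    isIntertwiningMap_comp (isIntertwiningMap_res hb P)
      (isIntertwiningMap_comp hf (isIntertwiningMap_res ha P))
  refine ⟨b ∘ₗ f ∘ₗ a, ⟨?_⟩, ?_⟩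
  · rintro ⟨_, x, hx, rfl⟩ v
    exact hf'.isIntertwining ⟨x, hx⟩ v
  · rw [← relTrace_relTrace hf', ← comp_relTrace hb, ← relTrace_comp ha, hid, LinearMap.id_comp,
      hab]

end RelProjective

/-! ### Induced modules and Higman's criterion. -/

section Induction

variable {K : Type u} [Field K] {G : Type v} [Group G]
  {R : Subgroup G} {X : Type w'} [AddCommGroup X] [Module K X] {σ : Representation K R X}
  {M : Type*} [AddCommGroup M] [Module K M]

/-- The linear map on an induced module given by a compatible family of linear maps. -/
noncomputable def indLift (σ : Representation K R X) (F : G → X →ₗ[K] M)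
    (hF : ∀ (r : R) (g : G) (x : X), F (r * g) (σ r x) = F g x) :
    IndV R.subtype σ →ₗ[K] M :=
  Representation.Coinvariants.lift _
    (TensorProduct.lift (Finsupp.lift _ _ _ F ∘ₗ (MonoidAlgebra.coeffLinearEquiv K).toLinearMap))
    fun r => by
      ext g x
      simp [hF]

theorem indLift_mk (F : G → X →ₗ[K] M)
    (hF : ∀ (r : R) (g : G) (x : X), F (r * g) (σ r x) = F g x) (g : G) (x : X) :
    indLift σ F hF (IndV.mk R.subtype σ g x) = F g x := by
  simp [indLift]

theorem indV_mk_mul (r : R) (g : G) (x : X) :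
    IndV.mk R.subtype σ (r * g) (σ r x) = IndV.mk R.subtype σ g x := by
  have := Coinvariants.mk_self_apply (Representation.tprod ((leftRegular K G).comp R.subtype) σ) r
    ((MonoidAlgebra.single g 1) ⊗ₜ x)
  simpa using this

open Classical in
/-- The coefficient at the identity. -/
noncomputable def indCoeff (σ : Representation K R X) : IndV R.subtype σ →ₗ[K] X :=
  -- The inverse occurs because `mk g x = mk 1 (σ g⁻¹ x)` for `g ∈ R`.
  indLift σ (fun g => if h : g ∈ R then σ ⟨g, h⟩⁻¹ else 0) fun r g x => by
    have : (r * g : G) ∈ R ↔ g ∈ R := Subgroup.mul_mem_cancel_left _ r.2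
    by_cases h : g ∈ R
    · have h' : (⟨r * g, this.mpr h⟩ : R) = r * ⟨g, h⟩ := rfl
      rw [dif_pos h, dif_pos (this.mpr h), h', mul_inv_rev, map_mul, Module.End.mul_apply,
        ← Module.End.mul_apply (σ r⁻¹), ← map_mul, inv_mul_cancel, map_one, Module.End.one_apply]
    · rw [dif_neg h, dif_neg (mt this.mp h)]
      rfl

theorem indCoeff_mk_of_mem (r : R) (x : X) :
    indCoeff σ (IndV.mk R.subtype σ r x) = σ r⁻¹ x := by
  rw [indCoeff, indLift_mk, dif_pos r.2]

theorem indCoeff_mk_of_notMem {g : G} (hg : g ∉ R) (x : X) :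
    indCoeff σ (IndV.mk R.subtype σ g x) = 0 := by
  rw [indCoeff, indLift_mk, dif_neg hg]
  rfl

theorem ind_apply_mk (h g : G) (x : X) :
    ind R σ h (IndV.mk R.subtype σ g x) = IndV.mk R.subtype σ (g * h⁻¹) x := by
  rw [ind, ind_mk]

theorem isIntertwiningMap_mk_one :
    IsIntertwiningMap σ (res R (ind R σ)) (IndV.mk R.subtype σ 1) := by
  refine ⟨fun r x => ?_⟩
  change _ = ind R σ (r : G) (IndV.mk R.subtype σ 1 x)
  rw [ind_apply_mk, one_mul, ← indV_mk_mul r (r : G)⁻¹, mul_inv_cancel]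

theorem isIntertwiningMap_indCoeff :
    IsIntertwiningMap (res R (ind R σ)) σ (indCoeff σ) := by
  refine ⟨fun r z => ?_⟩
  suffices h : indCoeff σ ∘ₗ ind R σ (r : G) = σ r ∘ₗ indCoeff σ from LinearMap.congr_fun h z
  refine IndV.hom_ext R.subtype σ fun g => ?_
  ext x
  change indCoeff σ (ind R σ (r : G) (IndV.mk R.subtype σ g x)) =
    σ r (indCoeff σ (IndV.mk R.subtype σ g x))
  rw [ind_apply_mk]
  by_cases hg : g ∈ R
  · have h1 := indCoeff_mk_of_mem (σ := σ) (⟨g, hg⟩ * r⁻¹) x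
    have h2 := indCoeff_mk_of_mem (σ := σ) ⟨g, hg⟩ x
    simp only [Subgroup.coe_mul, Subgroup.coe_inv] at h1 h2
    rw [h1, h2, mul_inv_rev, inv_inv, map_mul, Module.End.mul_apply]
  · rw [indCoeff_mk_of_notMem hg, indCoeff_mk_of_notMem, map_zero]
    rwa [Subgroup.mul_mem_cancel_right R (R.inv_mem r.2)]

variable [Finite G]

/-- The map inside the trace is the projection onto the component at the identity, and the induced
module is the direct sum of the translates of that component. On `mk g x` only the coset of `g⁻¹`
contributes. -/
theorem relTrace_mk_comp_indCoeff :
    relTrace R (ind R σ) (ind R σ) (IndV.mk R.subtype σ 1 ∘ₗ indCoeff σ) = LinearMap.id := by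
  let _ := Fintype.ofFinite (G ⧸ R)
  have hf : IsIntertwiningMap (res R (ind R σ)) (res R (ind R σ))
      (IndV.mk R.subtype σ 1 ∘ₗ indCoeff σ) :=
    isIntertwiningMap_comp isIntertwiningMap_mk_one isIntertwiningMap_indCoeff
  refine IndV.hom_ext R.subtype σ fun g => ?_
  ext x
  change relTrace R (ind R σ) (ind R σ) (IndV.mk R.subtype σ 1 ∘ₗ indCoeff σ)
    (IndV.mk R.subtype σ g x) = IndV.mk R.subtype σ g x
  rw [relTrace_eq_sum_traceTerm, LinearMap.sum_apply,
    Finset.sum_eq_single ((g⁻¹ : G) : G ⧸ R) _ (fun h => absurd (Finset.mem_univ _) h)]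
  · rw [traceTerm_mk hf]
    have h1 := indCoeff_mk_of_mem (σ := σ) 1 x
    simp only [Subgroup.coe_one, inv_one, map_one, Module.End.one_apply] at h1
    change ind R σ g⁻¹ (IndV.mk R.subtype σ 1
      (indCoeff σ (ind R σ g⁻¹⁻¹ (IndV.mk R.subtype σ g x)))) = _
    rw [ind_apply_mk g⁻¹⁻¹, inv_inv, mul_inv_cancel, h1, ind_apply_mk, one_mul, inv_inv]
  · intro q _ hq
    induction q using QuotientGroup.induction_on with
    | H h =>
    rw [traceTerm_mk hf]
    have hgh : g * h⁻¹⁻¹ ∉ R := by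
      intro hgh
      apply hq
      rw [eq_comm, QuotientGroup.eq]
      simpa using hgh
    change ind R σ h (IndV.mk R.subtype σ 1
      (indCoeff σ (ind R σ h⁻¹ (IndV.mk R.subtype σ g x)))) = 0
    rw [ind_apply_mk h⁻¹, indCoeff_mk_of_notMem hgh, map_zero, map_zero]

variable {V : Type w} [AddCommGroup V] [Module K V] {ρ : Representation K G V}

/-- Frobenius reciprocity on both sides: maps to and from the induced module correspond to the
`R`-maps `a` and `b`, and the composite through it is the trace of `b ∘ a`. -/
theorem isSummand_ind_iff : IsSummand ρ (ind R σ) ↔ ∃ (a : V →ₗ[K] X) (b : X →ₗ[K] V),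
    IsIntertwiningMap (res R ρ) σ a ∧ IsIntertwiningMap σ (res R ρ) b ∧
      relTrace R ρ ρ (b ∘ₗ a) = LinearMap.id := by
  constructor
  · intro h
    obtain ⟨i, r, hi, hr, e⟩ := isSummand_iff.mp h
    refine ⟨indCoeff σ ∘ₗ i, r ∘ₗ IndV.mk R.subtype σ 1,
      isIntertwiningMap_comp isIntertwiningMap_indCoeff (isIntertwiningMap_res hi R),
      isIntertwiningMap_comp (isIntertwiningMap_res hr R) isIntertwiningMap_mk_one, ?_⟩
    rw [LinearMap.comp_assoc, ← comp_relTrace hr, ← LinearMap.comp_assoc i, ← relTrace_comp hi,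
      relTrace_mk_comp_indCoeff, LinearMap.id_comp, e]
  · rintro ⟨a, b, ha, hb, e⟩
    let B : IndV R.subtype σ →ₗ[K] V := indLift σ (fun g => ρ g⁻¹ ∘ₗ b) fun r g x => by
      have := hb.isIntertwining r x
      simp only [LinearMap.comp_apply, this]
      simp only [res, MonoidHom.comp_apply, Subgroup.subtype_apply, ← Module.End.mul_apply,
        ← map_mul, mul_inv_rev, inv_mul_cancel_right]
    have hB : IsIntertwiningMap (ind R σ) ρ B := by
      refine ⟨fun h z => ?_⟩
      suffices H : B ∘ₗ ind R σ h = ρ h ∘ₗ B from LinearMap.congr_fun H z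
      refine IndV.hom_ext R.subtype σ fun g => ?_
      ext x
      change B (ind R σ h (IndV.mk R.subtype σ g x)) = ρ h (B (IndV.mk R.subtype σ g x))
      rw [ind_apply_mk, indLift_mk, indLift_mk]
      simp
    have hB1 : B ∘ₗ IndV.mk R.subtype σ 1 = b := by
      ext x
      change B (IndV.mk R.subtype σ 1 x) = b x
      rw [indLift_mk]
      simp
    rw [isSummand_iff]
    refine ⟨relTrace R ρ (ind R σ) (IndV.mk R.subtype σ 1 ∘ₗ a), B,
      isIntertwiningMap_relTrace (isIntertwiningMap_comp isIntertwiningMap_mk_one ha), hB, ?_⟩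
    rw [comp_relTrace hB, ← LinearMap.comp_assoc, hB1, e]

theorem isRelProjective_iff_hasTrace : IsRelProjective R ρ ↔ HasTrace R ρ := by
  rw [IsRelProjective, isSummand_ind_iff]
  constructor
  · rintro ⟨a, b, ha, hb, e⟩
    exact ⟨b ∘ₗ a, isIntertwiningMap_comp hb ha, e⟩
  · rintro ⟨f, hf, e⟩
    exact ⟨LinearMap.id, f, isIntertwiningMap_id, hf, e⟩

theorem isVertex_iff {Q : Subgroup G} :
    IsVertex Q ρ ↔ HasTrace Q ρ ∧ ∀ R : Subgroup G, HasTrace R ρ → R ≤ Q → Q ≤ R := by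
  simp only [IsVertex, Minimal, isRelProjective_iff_hasTrace]

end Induction

/-! ### Mackey decomposition of traces and conjugacy of vertices. -/

section Local

variable {K : Type u} [Field K] {G : Type v} [Group G] [Finite G]
  {V : Type w} [AddCommGroup V] [Module K V] {ρ : Representation K G V}

/-- An indecomposable summand of a restriction is relatively projective with respect to an
intersection with a conjugate. -/
theorem exists_bijective_relTrace_twist {S : Type*} [Group S] [Finite S] {φ : S →* G}
    {T : Type*} [AddCommGroup T] [Module K T] [FiniteDimensional K T] {τ : Representation K S T}
    (hτ : IsIndecomposable τ) {R : Subgroup G} {f : V →ₗ[K] V}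
    (hf : IsIntertwiningMap (res R ρ) (res R ρ) f) {i : T →ₗ[K] V} {r : V →ₗ[K] T}
    (hi : IsIntertwiningMap τ (ρ.comp φ) i) (hr : IsIntertwiningMap (ρ.comp φ) τ r)
    (h : Function.Bijective (r ∘ₗ relTrace R ρ ρ f ∘ₗ i)) :
    ∃ g : G, (g ∈ φ.range → g = 1) ∧ HasTrace (R.comap (twist φ g)) τ ∧
      Function.Bijective
        (relTrace (R.comap (twist φ g)) τ τ (r ∘ₗ (ρ g ∘ₗ f ∘ₗ ρ g⁻¹) ∘ₗ i)) := by
  obtain ⟨ι, _, g, hg, hsum⟩ := exists_relTrace_eq_sum.{u, v, w, w} (K := K) R φ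
  have hint : ∀ k, IsIntertwiningMap (res (R.comap (twist φ (g k))) τ)
      (res (R.comap (twist φ (g k))) τ) (r ∘ₗ (ρ (g k) ∘ₗ f ∘ₗ ρ (g k)⁻¹) ∘ₗ i) := fun k =>
    isIntertwiningMap_comp (isIntertwiningMap_res hr _)
      (isIntertwiningMap_comp (isIntertwiningMap_conj_twist hf φ (g k))
        (isIntertwiningMap_res hi _))
  have h1 : r ∘ₗ relTrace R ρ ρ f ∘ₗ i = ∑ k, relTrace (R.comap (twist φ (g k))) τ τ
      (r ∘ₗ (ρ (g k) ∘ₗ f ∘ₗ ρ (g k)⁻¹) ∘ₗ i) := by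
    rw [hsum ρ ρ f hf, sum_linearMap_comp, linearMap_comp_sum]
    exact Finset.sum_congr rfl fun k _ => by rw [relTrace_comp hi, comp_relTrace hr]
  rw [h1] at h
  obtain ⟨k, -, hk⟩ := exists_bijective_of_sum hτ Finset.univ
    (fun k _ => isIntertwiningMap_relTrace (hint k)) h
  exact ⟨g k, hg k, hasTrace_of_bijective (hint k) hk, hk⟩

/-- Mackey's formula along `j` splits the inner trace, so the whole map is a sum of traces from the
subgroups of `Q` that `h` conjugates into `P`; one summand is invertible by Fitting. It is used both
for `H = G` and for a subgroup `H` containing `Q`. -/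
theorem exists_hasTrace_of_bijective_comp [FiniteDimensional K V] (hρ : IsIndecomposable ρ)
    {Q : Subgroup G} {H : Type*} [Group H] [Finite H] {j : Q →* H} {κ : Representation K H V}
    (hκ : κ.comp j = res Q ρ) {P : Subgroup H} {f₁ f₂ : V →ₗ[K] V}
    (hf₁ : IsIntertwiningMap (res Q ρ) (res Q ρ) f₁)
    (hf₂ : IsIntertwiningMap (res P κ) (res P κ) f₂)
    (h : Function.Bijective (relTrace Q ρ ρ (f₁ ∘ₗ relTrace P κ κ f₂))) :
    ∃ h : H, HasTrace ((P.comap (twist j h)).map Q.subtype) ρ := by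
  obtain ⟨ι, _, g, -, hsum⟩ := exists_relTrace_eq_sum.{u, _, w, w} (K := K) P j
  have hint : ∀ k, IsIntertwiningMap (res (P.comap (twist j (g k))) (res Q ρ))
      (res (P.comap (twist j (g k))) (res Q ρ)) (f₁ ∘ₗ κ (g k) ∘ₗ f₂ ∘ₗ κ (g k)⁻¹) := fun k =>
    isIntertwiningMap_comp (isIntertwiningMap_res hf₁ _)
      (hκ ▸ isIntertwiningMap_conj_twist hf₂ j (g k))
  have hint' : ∀ k, IsIntertwiningMap (res ((P.comap (twist j (g k))).map Q.subtype) ρ)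
      (res ((P.comap (twist j (g k))).map Q.subtype) ρ)
      (f₁ ∘ₗ κ (g k) ∘ₗ f₂ ∘ₗ κ (g k)⁻¹) := by
    refine fun k => ⟨?_⟩
    rintro ⟨_, x, hx, rfl⟩ v
    exact (hint k).isIntertwining ⟨x, hx⟩ v
  have h1 : relTrace Q ρ ρ (f₁ ∘ₗ relTrace P κ κ f₂) =
      ∑ k, relTrace ((P.comap (twist j (g k))).map Q.subtype) ρ ρ
        (f₁ ∘ₗ κ (g k) ∘ₗ f₂ ∘ₗ κ (g k)⁻¹) := by
    rw [hsum κ κ f₂ hf₂, linearMap_comp_sum, relTrace_sum]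
    refine Finset.sum_congr rfl fun k _ => ?_
    rw [hκ, comp_relTrace hf₁, relTrace_relTrace (hint k)]
  rw [h1] at h
  obtain ⟨k, -, hk⟩ := exists_bijective_of_sum hρ Finset.univ
    (fun k _ => isIntertwiningMap_relTrace (hint' k)) h
  exact ⟨g k, hasTrace_of_bijective (hint' k) hk⟩

/-- V is projective relative to Q ∩ hPh⁻¹ for some h, and minimality makes this all of Q. -/
theorem IsVertex.exists_conj_le [FiniteDimensional K V] (hρ : IsIndecomposable ρ)
    {P Q : Subgroup G} (hQ : IsVertex Q ρ) (hP : HasTrace P ρ) :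
    ∃ h : G, ∀ x ∈ Q, h⁻¹ * x * h ∈ P := by
  rw [isVertex_iff] at hQ
  obtain ⟨⟨f₁, hf₁, e₁⟩, hmin⟩ := hQ
  obtain ⟨f₂, hf₂, e₂⟩ := hP
  have hb : Function.Bijective (relTrace Q ρ ρ (f₁ ∘ₗ relTrace P ρ ρ f₂)) := by
    rw [e₂, LinearMap.comp_id, e₁]
    exact Function.bijective_id
  obtain ⟨h, hh⟩ := exists_hasTrace_of_bijective_comp hρ (j := Q.subtype) rfl hf₁ hf₂ hb
  refine ⟨h, fun x hx => ?_⟩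
  obtain ⟨y, hy, rfl⟩ := hmin _ hh (Subgroup.map_subtype_le _) hx
  exact mem_comap_twist.mp hy

end Local

/-! ### Components of a restriction that still carry the identity trace. -/

section Summand

variable {K : Type u} [Field K] {G : Type v} [Group G] [Finite G]

/-- Invertibility of the trace of `f ∘ x` passes from a sum in `x` to one of its terms, by Fitting.
The resulting component B of the restriction satisfies V ∣ Ind B. -/
theorem exists_indecomposable_trace_summand (V : IndecModule K G) {Q : Subgroup G}
    {f : V.carrier →ₗ[K] V.carrier} (hf : IsIntertwiningMap (res Q V.ρ) (res Q V.ρ) f)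
    (h : relTrace Q V.ρ V.ρ f = LinearMap.id) :
    ∃ (B : IndecModule K Q) (i : B.carrier →ₗ[K] V.carrier) (r : V.carrier →ₗ[K] B.carrier),
      IsIntertwiningMap B.ρ (res Q V.ρ) i ∧ IsIntertwiningMap (res Q V.ρ) B.ρ r ∧
        r ∘ₗ i = LinearMap.id ∧ Function.Bijective (relTrace Q V.ρ V.ρ (f ∘ₗ i ∘ₗ r)) := by
  have hV := V.indecomposable
  have := hV.1
  refine exists_indecomposable_summand (res Q V.ρ)
    (fun x => Function.Bijective (relTrace Q V.ρ V.ρ (f ∘ₗ x))) ?_ ?_ ?_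
  · rw [LinearMap.comp_zero, relTrace_zero]
    intro h0
    obtain ⟨v, hv⟩ := exists_ne (0 : V.carrier)
    exact hv (h0.1 rfl)
  · intro x y hx hy hxy
    rw [LinearMap.comp_add, relTrace_add] at hxy
    exact bijective_or_bijective_of_add hV
      (isIntertwiningMap_relTrace (isIntertwiningMap_comp hf hx))
      (isIntertwiningMap_relTrace (isIntertwiningMap_comp hf hy)) hxy
  · rw [LinearMap.comp_id, h]
    exact Function.bijective_id

theorem exists_relTrace_eq_id {V : Type w} [AddCommGroup V] [Module K V] {ρ : Representation K G V}
    {Q : Subgroup G} {X : Type w'} [AddCommGroup X] [Module K X] {σ : Representation K Q X}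
    {a : V →ₗ[K] X} {b : X →ₗ[K] V} (ha : IsIntertwiningMap (res Q ρ) σ a)
    (hb : IsIntertwiningMap σ (res Q ρ) b) (h : Function.Bijective (relTrace Q ρ ρ (b ∘ₗ a))) :
    ∃ a' : V →ₗ[K] X, IsIntertwiningMap (res Q ρ) σ a' ∧
      relTrace Q ρ ρ (b ∘ₗ a') = LinearMap.id := by
  let e := LinearEquiv.ofBijective (relTrace Q ρ ρ (b ∘ₗ a)) h
  have he : IsIntertwiningMap ρ ρ e.symm.toLinearMap :=
    isIntertwiningMap_symm (e := e) (isIntertwiningMap_relTrace (isIntertwiningMap_comp hb ha))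
  refine ⟨a ∘ₗ e.symm.toLinearMap, isIntertwiningMap_comp ha (isIntertwiningMap_res he Q), ?_⟩
  rw [← LinearMap.comp_assoc, ← relTrace_comp he]
  ext v
  exact e.apply_symm_apply v

end Summand

/-! ### Green correspondence. -/

section Green

variable {K : Type u} [Field K] {G : Type v} [Group G] [Finite G]

omit [Finite G] in
theorem comap_twist_one {H R : Subgroup G} : R.comap (twist H.subtype 1) = R.subgroupOf H := by
  ext x
  rw [mem_comap_twist]
  simp [Subgroup.mem_subgroupOf]

variable {Q H : Subgroup G} (hQH : Q ≤ H) (hH : ∀ g : G, (∀ x ∈ Q, g⁻¹ * x * g ∈ Q) → g ∈ H)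
include hQH hH

/-- The existence of the Green correspondent, together with the relative projectivity of `V` with
respect to it. -/
theorem exists_greenCorrespondent {V : IndecModule K G} (hV : IsVertex Q V.ρ) :
    ∃ B : IndecModule K H, IsVertex (Q.subgroupOf H) B.ρ ∧ IsSummand B.ρ (res H V.ρ) ∧
      ∃ (a : V.carrier →ₗ[K] B.carrier) (b : B.carrier →ₗ[K] V.carrier),
        IsIntertwiningMap (res H V.ρ) B.ρ a ∧ IsIntertwiningMap B.ρ (res H V.ρ) b ∧
          relTrace H V.ρ V.ρ (b ∘ₗ a) = LinearMap.id := by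
  obtain ⟨⟨f, hf, hid⟩, hmin⟩ := isVertex_iff.mp hV
  have hmap : (Q.subgroupOf H).map H.subtype = Q := Subgroup.map_subgroupOf_eq_of_le hQH
  have hf' : ∀ {x : V.carrier →ₗ[K] V.carrier}, IsIntertwiningMap (res Q V.ρ) (res Q V.ρ) x →
      IsIntertwiningMap (res (Q.subgroupOf H) (res H V.ρ)) (res (Q.subgroupOf H) (res H V.ρ)) x :=
    fun hx => ⟨fun g v => hx.isIntertwining ⟨g, g.2⟩ v⟩
  have htr : ∀ {x : V.carrier →ₗ[K] V.carrier}, IsIntertwiningMap (res Q V.ρ) (res Q V.ρ) x →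
      relTrace H V.ρ V.ρ (relTrace (Q.subgroupOf H) (res H V.ρ) (res H V.ρ) x) =
        relTrace Q V.ρ V.ρ x := fun hx => by rw [relTrace_relTrace (hf' hx), hmap]
  have hF := isIntertwiningMap_relTrace (hf' hf)
  obtain ⟨B, i, r, hi, hr, hri, hbij⟩ :=
    -- The trace of `f` from `Q` to `H` has trace the identity from `H` to `G`, so `V` divides the
    -- module induced from `B`.
    exists_indecomposable_trace_summand V hF ((htr hf).trans hid)
  obtain ⟨a, ha, hab⟩ := exists_relTrace_eq_id hr (isIntertwiningMap_comp hF hi) hbij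
  refine ⟨B, isVertex_iff.mpr ⟨?_, ?_⟩, isSummand_iff.mpr ⟨i, r, hi, hr, hri⟩, a, _, ha,
    isIntertwiningMap_comp hF hi, hab⟩
  · have h1 : Function.Bijective (r ∘ₗ relTrace Q V.ρ V.ρ f ∘ₗ i) := by
      rw [hid, LinearMap.id_comp, hri]
      exact Function.bijective_id
    -- Mackey makes `B` projective relative to H ∩ gQg⁻¹; it remains to show `g = 1`.
    obtain ⟨g, hg, ⟨ψ, hψ, hψid⟩, -⟩ :=
      exists_bijective_relTrace_twist (φ := H.subtype) B.indecomposable hf hi hr h1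
    have hir := isIntertwiningMap_comp hi hr
    have hQir : IsIntertwiningMap (res Q V.ρ) (res Q V.ρ) (f ∘ₗ i ∘ₗ r) :=
      isIntertwiningMap_comp hf ⟨fun x v => hir.isIntertwining ⟨x, hQH x.2⟩ v⟩
    rw [relTrace_comp hir, htr hQir] at hbij
    have h2 : i ∘ₗ r = relTrace (Q.comap (twist H.subtype g)) (res H V.ρ) (res H V.ρ)
        (i ∘ₗ ψ ∘ₗ r) := by
      rw [← comp_relTrace hi, ← relTrace_comp hr, hψid, LinearMap.id_comp]
    have h3 := isIntertwiningMap_comp (isIntertwiningMap_res hi _)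
      (isIntertwiningMap_comp hψ (isIntertwiningMap_res hr _))
    rw [h2] at hbij
    obtain ⟨h, hh⟩ := exists_hasTrace_of_bijective_comp V.indecomposable
      (j := Subgroup.inclusion hQH) (κ := res H V.ρ) rfl hf h3 hbij
    -- `V` is projective relative to Q ∩ (hg)Q(hg)⁻¹, so minimality of `Q` makes `h * g` normalize
    -- `Q`. Hence `g ∈ H`, and the choice of representatives gives `g = 1`.
    have h4 : (h : G) * g ∈ H := by
      refine hH _ fun x hx => ?_
      obtain ⟨y, hy, rfl⟩ := hmin _ hh (Subgroup.map_subtype_le _) hx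
      have := mem_comap_twist.mp (mem_comap_twist.mp hy)
      simpa [mul_assoc] using this
    have h5 : g = 1 := hg (by
      rw [Subgroup.range_subtype]
      exact (Subgroup.mul_mem_cancel_left H h.2).mp h4)
    rw [h5, comap_twist_one] at hψ hψid
    exact ⟨ψ, hψ, hψid⟩
  · intro P hP hPQ x hx
    -- A smaller `P` for `B` would be a smaller subgroup for `V`, since `V` divides the module
    -- induced from `B`.
    have h1 := hmin _ (hP.trans ha (isIntertwiningMap_comp hF hi) hab)
      ((Subgroup.map_mono hPQ).trans hmap.le) hx
    obtain ⟨y, hy, hyx⟩ := h1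
    rwa [← Subtype.ext hyx]

/-- The indecomposable modules with vertex `Q` that divide the restriction of a module which is
relatively projective with respect to a `Q`-projective module `M` are summands of `M`. -/
theorem isSummand_of_isSummand_res {Y : Type w} [AddCommGroup Y] [Module K Y]
    {υ : Representation K G Y} {M : Type w'} [AddCommGroup M] [Module K M]
    {μ : Representation K H M} (hμ : HasTrace (Q.subgroupOf H) μ) {a : Y →ₗ[K] M} {b : M →ₗ[K] Y}
    (ha : IsIntertwiningMap (res H υ) μ a) (hb : IsIntertwiningMap μ (res H υ) b)
    (hab : relTrace H υ υ (b ∘ₗ a) = LinearMap.id) {A : Type*} [AddCommGroup A] [Module K A]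
    [FiniteDimensional K A] {α : Representation K H A} (hα : IsIndecomposable α)
    (hvertex : IsVertex (Q.subgroupOf H) α) (hAY : IsSummand α (res H υ)) : IsSummand α μ := by
  obtain ⟨ψ, hψ, hψid⟩ := hμ
  obtain ⟨i, r, hi, hr, hri⟩ := isSummand_iff.mp hAY
  have h1 : IsIntertwiningMap (res (Q.subgroupOf H) (res H υ)) (res (Q.subgroupOf H) (res H υ))
      (b ∘ₗ ψ ∘ₗ a) := isIntertwiningMap_comp (isIntertwiningMap_res hb _)
        (isIntertwiningMap_comp hψ (isIntertwiningMap_res ha _))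
  have h2 : IsIntertwiningMap (res Q υ) (res Q υ) (b ∘ₗ ψ ∘ₗ a) :=
    ⟨fun x v => h1.isIntertwining ⟨⟨x, hQH x.2⟩, x.2⟩ v⟩
  have h3 : relTrace Q υ υ (b ∘ₗ ψ ∘ₗ a) = LinearMap.id := by
    have := relTrace_relTrace h1
    rw [Subgroup.map_subgroupOf_eq_of_le hQH] at this
    rw [← this, ← comp_relTrace hb, ← relTrace_comp ha, hψid, LinearMap.id_comp, hab]
  have h4 : Function.Bijective (r ∘ₗ relTrace Q υ υ (b ∘ₗ ψ ∘ₗ a) ∘ₗ i) := by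
    rw [h3, LinearMap.id_comp, hri]
    exact Function.bijective_id
  obtain ⟨g, hg, hP, hbij⟩ := exists_bijective_relTrace_twist (φ := H.subtype) hα h2 hi hr h4
  -- The vertex is conjugate into H ∩ gQg⁻¹, which again forces `g = 1`. The bijective trace then
  -- becomes a composite `A → M → A`.
  obtain ⟨h, hh⟩ := hvertex.exists_conj_le hα hP
  have h5 : (h : G) * g ∈ H := by
    refine hH _ fun x hx => ?_
    have := mem_comap_twist.mp (hh ⟨x, hQH hx⟩ hx)
    simpa [mul_assoc] using this
  have h6 : g = 1 := hg (by
    rw [Subgroup.range_subtype]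
    exact (Subgroup.mul_mem_cancel_left H h.2).mp h5)
  subst h6
  have h7 : r ∘ₗ (υ 1 ∘ₗ (b ∘ₗ ψ ∘ₗ a) ∘ₗ υ 1⁻¹) ∘ₗ i = (r ∘ₗ b) ∘ₗ ψ ∘ₗ a ∘ₗ i := by
    ext v
    simp
  have hai := isIntertwiningMap_comp ha hi
  have hrb := isIntertwiningMap_comp hr hb
  rw [comap_twist_one, h7, ← comp_relTrace hrb, ← relTrace_comp hai, hψid, LinearMap.id_comp]
    at hbij
  exact isSummand_of_bijective hai hrb hbij

end Green

/-! ### Conjugacy of sources. -/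

section Source

variable {K : Type u} [Field K] {G : Type v} [Group G] {Q : Subgroup G}

theorem mem_normalizer_of_conj_mem [Finite G] {g : G} (h : ∀ x ∈ Q, g⁻¹ * x * g ∈ Q) :
    g ∈ Subgroup.normalizer (Q : Set G) := by
  rw [← inv_mem_iff, Subgroup.mem_normalizer_iff_conj_image_eq]
  refine Set.eq_of_subset_of_ncard_le ?_
    (Set.ncard_image_of_injective _ (MulAut.conj _).injective).ge
  rintro _ ⟨x, hx, rfl⟩
  simpa using h x hx

theorem IsIndecomposable.comp_of_surjective {H : Type*} [Group H] {φ : H →* G}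
    (hφ : Function.Surjective φ) {V : Type w} [AddCommGroup V] [Module K V]
    {ρ : Representation K G V} (hρ : IsIndecomposable ρ) : IsIndecomposable (ρ.comp φ) := by
  refine ⟨hρ.1, fun A B hAB => ?_⟩
  have key : ∀ A : Subrepresentation (ρ.comp φ), ∃ A' : Subrepresentation ρ,
      A'.toSubmodule = A.toSubmodule := fun A => ⟨⟨A.toSubmodule, fun g v hv => by
    obtain ⟨h, rfl⟩ := hφ g
    exact A.apply_mem_toSubmodule h hv⟩, rfl⟩
  obtain ⟨A', hA⟩ := key A
  obtain ⟨B', hB⟩ := key B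
  have hc : IsCompl A' B' := by
    constructor
    · rw [disjoint_iff]
      apply Subrepresentation.toSubmodule_injective
      rw [Subrepresentation.toSubmodule_inf, hA, hB]
      exact congrArg Subrepresentation.toSubmodule hAB.inf_eq_bot
    · rw [codisjoint_iff]
      apply Subrepresentation.toSubmodule_injective
      rw [Subrepresentation.toSubmodule_sup, hA, hB]
      exact congrArg Subrepresentation.toSubmodule hAB.sup_eq_top
  refine (hρ.2 A' B' hc).imp (fun h => ?_) (fun h => ?_)
  · apply Subrepresentation.toSubmodule_injective
    rw [← hA, h]
    rfl
  · apply Subrepresentation.toSubmodule_injective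
    rw [← hB, h]
    rfl

theorem IsIndecomposable.nonempty_equiv_of_isSummand {V : Type w} [AddCommGroup V] [Module K V]
    {ρ : Representation K G V} {W : Type w'} [AddCommGroup W] [Module K W] [FiniteDimensional K W]
    {σ : Representation K G W} [Nontrivial V] (hσ : IsIndecomposable σ) (h : IsSummand ρ σ) :
    Nonempty (ρ.Equiv σ) := by
  obtain ⟨i, r, hi, hr, hri⟩ := isSummand_iff.mp h
  rcases isNilpotent_or_bijective hσ (isIntertwiningMap_comp hi hr) with ⟨n, hn⟩ | hb
  · have hpow : ∀ n : ℕ, ((i ∘ₗ r : Module.End K W) ^ n) ∘ₗ i = i := by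
      intro n
      induction n with
      | zero => rfl
      | succ n ih =>
        rw [pow_succ, Module.End.mul_eq_comp, LinearMap.comp_assoc, LinearMap.comp_assoc, hri,
          LinearMap.comp_id, ih]
    have hi0 := hpow n
    rw [hn, LinearMap.zero_comp] at hi0
    rw [← hi0, LinearMap.comp_zero] at hri
    obtain ⟨v, hv⟩ := exists_ne (0 : V)
    exact absurd (LinearMap.congr_fun hri v).symm hv
  · have hinj : Function.Injective i := Function.LeftInverse.injective (LinearMap.congr_fun hri)
    have hsurj : Function.Surjective i := Function.Surjective.of_comp hb.2
    exact ⟨(toIntertwining hi).ofBijective ⟨hinj, hsurj⟩⟩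

theorem normalizerMonoidHom_inv_apply_apply (h : Subgroup.normalizer (Q : Set G)) (q : Q) :
    Q.normalizerMonoidHom h (Q.normalizerMonoidHom h⁻¹ q) = q := by
  rw [← MulAut.mul_apply, ← map_mul, mul_inv_cancel, map_one, MulAut.one_apply]

theorem IsSummand.conj_mul_inv {V : Type w} [AddCommGroup V] [Module K V]
    {ρ : Representation K Q V} {W : Type w'} [AddCommGroup W] [Module K W]
    {σ : Representation K Q W} {h₁ h₂ : Subgroup.normalizer (Q : Set G)}
    (h : IsSummand (conj Q h₁ ρ) (conj Q h₂ σ)) : IsSummand (conj Q (h₁ * h₂⁻¹) ρ) σ := by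
  obtain ⟨i, r, hi, hr, hri⟩ := isSummand_iff.mp h
  have e₁ : ∀ q, conj Q h₁ ρ (Q.normalizerMonoidHom h₂⁻¹ q) = conj Q (h₁ * h₂⁻¹) ρ q := by
    intro q
    simp only [conj, MonoidHom.comp_apply, map_mul]
    rfl
  have e₂ : ∀ q, conj Q h₂ σ (Q.normalizerMonoidHom h₂⁻¹ q) = σ q := by
    intro q
    exact congrArg σ (normalizerMonoidHom_inv_apply_apply h₂ q)
  rw [isSummand_iff]
  refine ⟨i, r, ⟨fun q v => ?_⟩, ⟨fun q v => ?_⟩, hri⟩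
  · rw [← e₁, hi.isIntertwining, e₂]
  · rw [← e₁, ← e₂, hr.isIntertwining]

/-- Mackey makes T projective relative to Q ∩ gQg⁻¹. By hypothesis this is all of Q, so g normalizes
Q, the remaining trace is trivial, and the invertible map factors through a conjugate of X. -/
theorem exists_isSummand_conj_of_isSummand_ind [Finite G] {T : IndecModule K Q}
    (hT : ∀ P : Subgroup Q, HasTrace P T.ρ → P = ⊤) {Y : Type w} [AddCommGroup Y] [Module K Y]
    {υ : Representation K G Y} (hTY : IsSummand T.ρ (res Q υ)) {X : Type w'} [AddCommGroup X]
    [Module K X] {σ : Representation K Q X} (hX : IsSummand υ (ind Q σ)) :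
    ∃ h : Subgroup.normalizer (Q : Set G), IsSummand T.ρ (conj Q h σ) := by
  obtain ⟨i, r, hi, hr, hri⟩ := isSummand_iff.mp hTY
  obtain ⟨a, b, ha, hb, hab⟩ := isSummand_ind_iff.mp hX
  have h1 : Function.Bijective (r ∘ₗ relTrace Q υ υ (b ∘ₗ a) ∘ₗ i) := by
    rw [hab, LinearMap.id_comp, hri]
    exact Function.bijective_id
  have hba := isIntertwiningMap_comp hb ha
  obtain ⟨g, -, hP, hbij⟩ :=
    exists_bijective_relTrace_twist (φ := Q.subtype) T.indecomposable hba hi hr h1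
  have htop := hT _ hP
  have hconj : ∀ x : Q, g⁻¹ * x * g ∈ Q := fun x =>
    (mem_comap_twist (φ := Q.subtype)).mp (htop ▸ Subgroup.mem_top x)
  have hg : g⁻¹ ∈ Subgroup.normalizer (Q : Set G) :=
    inv_mem (mem_normalizer_of_conj_mem fun x hx => hconj ⟨x, hx⟩)
  have hσ : ∀ q : Q, conj Q ⟨g⁻¹, hg⟩ σ q = σ ⟨g⁻¹ * q * g, hconj q⟩ := by
    intro q
    have : Q.normalizerMonoidHom ⟨g⁻¹, hg⟩ q = ⟨g⁻¹ * q * g, hconj q⟩ :=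
      Subtype.ext (congrArg (fun x => g⁻¹ * q * x) (inv_inv g))
    exact congrArg σ this
  have hα : IsIntertwiningMap T.ρ (conj Q ⟨g⁻¹, hg⟩ σ) (a ∘ₗ υ g⁻¹ ∘ₗ i) := by
    refine ⟨fun q v => ?_⟩
    have h2 := ha.isIntertwining ⟨g⁻¹ * q * g, hconj q⟩ (υ g⁻¹ (i v))
    rw [hσ, LinearMap.comp_apply, LinearMap.comp_apply, LinearMap.comp_apply,
      LinearMap.comp_apply, ← h2, hi.isIntertwining]
    simp only [res, MonoidHom.comp_apply, Subgroup.subtype_apply, ← Module.End.mul_apply,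
      ← map_mul, mul_assoc, mul_inv_cancel, mul_one]
  have hβ : IsIntertwiningMap (conj Q ⟨g⁻¹, hg⟩ σ) T.ρ (r ∘ₗ υ g ∘ₗ b) := by
    refine ⟨fun q v => ?_⟩
    have h2 := hb.isIntertwining ⟨g⁻¹ * q * g, hconj q⟩ v
    rw [hσ, LinearMap.comp_apply, LinearMap.comp_apply, LinearMap.comp_apply,
      LinearMap.comp_apply, h2, ← hr.isIntertwining]
    simp only [res, MonoidHom.comp_apply, Subgroup.subtype_apply, ← Module.End.mul_apply,
      ← map_mul, mul_assoc, mul_inv_cancel_left]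
  refine ⟨⟨g⁻¹, hg⟩, isSummand_of_bijective hα hβ ?_⟩
  rw [htop] at hbij
  have h3 : r ∘ₗ (υ g ∘ₗ (b ∘ₗ a) ∘ₗ υ g⁻¹) ∘ₗ i = (r ∘ₗ υ g ∘ₗ b) ∘ₗ a ∘ₗ υ g⁻¹ ∘ₗ i := rfl
  rwa [h3, relTrace_top (isIntertwiningMap_comp hβ hα)] at hbij

/-- The sources of a module are conjugate under the normalizer of the vertex. -/
theorem exists_isSummand_conj [Finite G] {Y : IndecModule K G} (hY : IsVertex Q Y.ρ)
    {S : IndecModule K Q} {X : Type w} [AddCommGroup X] [Module K X] {σ : Representation K Q X}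
    (hS : IsSummand Y.ρ (ind Q S.ρ)) (hX : IsSummand Y.ρ (ind Q σ)) :
    ∃ h : Subgroup.normalizer (Q : Set G), IsSummand (conj Q h S.ρ) σ := by
  obtain ⟨⟨f, hf, hid⟩, hmin⟩ := isVertex_iff.mp hY
  -- `T` is a go-between with full vertex `Q`: it divides a conjugate of `S`, hence is isomorphic to
  -- it, and also divides a conjugate of `σ`.
  obtain ⟨T, i, r, hi, hr, hri, hbij⟩ := exists_indecomposable_trace_summand Y hf hid
  obtain ⟨a, ha, hab⟩ := exists_relTrace_eq_id hr (isIntertwiningMap_comp hf hi) hbij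
  have htop : ∀ P : Subgroup Q, HasTrace P T.ρ → P = ⊤ := by
    intro P hP
    rw [eq_top_iff]
    intro x _
    obtain ⟨y, hy, hyx⟩ := hmin _ (hP.trans ha (isIntertwiningMap_comp hf hi) hab)
      (Subgroup.map_subtype_le _) x.2
    rwa [← Subtype.ext hyx]
  have hTY : IsSummand T.ρ (res Q Y.ρ) := isSummand_iff.mpr ⟨i, r, hi, hr, hri⟩
  obtain ⟨h₁, hh₁⟩ := exists_isSummand_conj_of_isSummand_ind htop hTY hS
  obtain ⟨h₂, hh₂⟩ := exists_isSummand_conj_of_isSummand_ind htop hTY hX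
  have hconj : IsIndecomposable (conj Q h₁ S.ρ) :=
    S.indecomposable.comp_of_surjective (Q.normalizerMonoidHom h₁).surjective
  have := T.indecomposable.1
  obtain ⟨e⟩ := hconj.nonempty_equiv_of_isSummand hh₁
  exact ⟨h₁ * h₂⁻¹, ((isSummand_of_equiv e.symm).trans hh₂).conj_mul_inv⟩

end Source

/-! ### Towers of fields and restriction of scalars. -/

section Tower

variable {F : Type u} [Field F] {K : Type*} [Field K] [Algebra F K] {L : Type*} [Field L]
  [Algebra F L] [Algebra K L] [IsScalarTower F K L] {G : Type v} [Group G]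

/-- Transitivity of the extension of scalars. -/
noncomputable def baseChangeBaseChange {V : Type w} [AddCommGroup V] [Module F V]
    (ρ : Representation F G V) : (baseChange L (baseChange K ρ)).Equiv (baseChange L ρ) :=
  Representation.Equiv.mk (TensorProduct.AlgebraTensorModule.cancelBaseChange F K L L V) fun g => by
    ext v
    simp [baseChange]

variable {V : Type w} [AddCommGroup V] [Module F V] [Module K V] [IsScalarTower F K V]

/-- The restriction of scalars of a representation. -/
def restrictScalars (F : Type*) {K : Type*} [Field F] [Field K] [Algebra F K] {G : Type*} [Group G]
    {V : Type*} [AddCommGroup V] [Module F V] [Module K V] [IsScalarTower F K V]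
    (ρ : Representation K G V) : Representation F G V where
  toFun g := (ρ g).restrictScalars F
  map_one' := by ext; simp
  map_mul' g h := by ext; simp

/-- A module over a finite separable extension is a summand of the scalar extension of its
restriction of scalars. -/
theorem isSummand_baseChange_restrictScalars [FiniteDimensional F K] [Algebra.IsSeparable F K]
    (ρ : Representation K G V) : IsSummand ρ (baseChange K (restrictScalars F ρ)) := by
  have : Algebra.FormallyUnramified F K := Algebra.FormallyUnramified.of_isSeparable F K
  rw [isSummand_iff]
  -- The separability idempotent of K ⊗ K gives a section of the multiplication map K ⊗ V → V; it
  -- uses only scalars, so it commutes with `G`.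
  refine ⟨Algebra.FormallyUnramified.sec F K V,
    TensorProduct.AlgebraTensorModule.lift
      ((Algebra.lsmul K K V).toLinearMap.flip.restrictScalars F).flip, ⟨fun g v => ?_⟩,
    ⟨fun g z => ?_⟩, Algebra.FormallyUnramified.comp_sec F K V⟩
  · simp only [Algebra.FormallyUnramified.sec, LinearMap.coe_mk, LinearMap.coe_toAddHom,
      LinearMap.coe_comp, Function.comp_apply, LinearMap.flip_apply,
      TensorProduct.AlgebraTensorModule.mapBilinear_apply]
    induction Algebra.FormallyUnramified.elem F K using TensorProduct.induction_on with
    | zero => simp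
    | tmul r s => simp [baseChange, restrictScalars]
    | add y z hy hz => simp only [map_add, hy, hz]
  · induction z using TensorProduct.induction_on with
    | zero => simp
    | tmul r s => simp [baseChange, restrictScalars]
    | add y z hy hz => simp only [map_add, hy, hz]

end Tower

/-! ### Descent to finite subextensions and to the base field. -/

section Descent

variable {F : Type u} [Field F] {L : Type u} [Field L] [Algebra F L]
  {G : Type v} [Group G]

/-- Since `Y` is indecomposable, some component of `ρ` has a projection that stays bijective over
`L`; its extension is then all of `Y`. -/
theorem exists_indecomposable_of_equiv_baseChange {K : Type u} [Field K] [Algebra K L]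
    (Y : IndecModule L G) {V : Type u} [AddCommGroup V] [Module K V] [FiniteDimensional K V]
    (ρ : Representation K G V) (e : (baseChange L ρ).Equiv Y.ρ) :
    ∃ B : IndecModule K G, Nonempty ((baseChange L B.ρ).Equiv Y.ρ) := by
  have hY := Y.indecomposable
  have := hY.1
  have he := isIntertwiningMap_of_intertwiningMap e.toIntertwiningMap
  have he' := isIntertwiningMap_of_intertwiningMap e.symm.toIntertwiningMap
  have hcomp : e.toLinearMap ∘ₗ e.symm.toLinearMap = LinearMap.id := by
    ext y
    exact e.apply_symm_apply y
  have hint : ∀ {x : V →ₗ[K] V}, IsIntertwiningMap ρ ρ x → IsIntertwiningMap Y.ρ Y.ρ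
      (e.toLinearMap ∘ₗ x.baseChange L ∘ₗ e.symm.toLinearMap) := fun hx =>
    isIntertwiningMap_comp he (isIntertwiningMap_comp (isIntertwiningMap_baseChange hx) he')
  obtain ⟨B, i, r, hi, hr, hri, hb⟩ := exists_indecomposable_summand ρ
    (fun x => Function.Bijective (e.toLinearMap ∘ₗ x.baseChange L ∘ₗ e.symm.toLinearMap))
    (fun h0 => by
      rw [LinearMap.baseChange_zero, LinearMap.zero_comp, LinearMap.comp_zero] at h0
      obtain ⟨v, hv⟩ := exists_ne (0 : Y.carrier)
      exact hv (h0.1 rfl))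
    (fun x y hx hy hxy => by
      rw [LinearMap.baseChange_add, LinearMap.add_comp, LinearMap.comp_add] at hxy
      exact bijective_or_bijective_of_add hY (hint hx) (hint hy) hxy)
    (by
      rw [LinearMap.baseChange_id, LinearMap.id_comp, hcomp]
      exact Function.bijective_id)
  refine ⟨B, ?_⟩
  rw [LinearMap.baseChange_comp, LinearMap.comp_assoc, ← LinearMap.comp_assoc] at hb
  have h1 := isIntertwiningMap_comp he (isIntertwiningMap_baseChange (L := L) hi)
  have hinj : Function.Injective (e.toLinearMap ∘ₗ i.baseChange L) := by
    rw [LinearMap.coe_comp]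
    refine Function.Injective.comp e.toLinearEquiv.injective
      (Function.LeftInverse.injective (g := r.baseChange L) fun z => ?_)
    rw [← LinearMap.comp_apply, ← LinearMap.baseChange_comp, hri, LinearMap.baseChange_id,
      LinearMap.id_apply]
  have hsurj : Function.Surjective (e.toLinearMap ∘ₗ i.baseChange L) :=
    Function.Surjective.of_comp hb.2
  exact ⟨(toIntertwining h1).ofBijective ⟨hinj, hsurj⟩⟩

/-- Every module over an algebraic extension is defined over a finite subextension. -/
theorem exists_equiv_baseChange [Algebra.IsAlgebraic F L] [Finite G] (Y : IndecModule L G) :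
    ∃ (K : IntermediateField F L) (_ : FiniteDimensional F K) (V : IndecModule K G),
      Nonempty ((baseChange L V.ρ).Equiv Y.ρ) := by
  classical
  let n := Module.finrank L Y.carrier
  let b := Module.finBasis L Y.carrier
  -- The matrix entries of all group elements: finitely many algebraic elements, which generate the
  -- field of definition.
  let S : Set L := Set.range fun x : G × Fin n × Fin n => b.repr (Y.ρ x.1 (b x.2.2)) x.2.1
  have hS : S.Finite := Set.finite_range _
  let K := IntermediateField.adjoin F S
  have : Finite S := hS
  have hK : FiniteDimensional F K := IntermediateField.finiteDimensional_adjoin fun x _ =>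
    Algebra.IsIntegral.isIntegral x
  let M : G → Matrix (Fin n) (Fin n) K := fun g i j =>
    ⟨b.repr (Y.ρ g (b j)) i, IntermediateField.subset_adjoin F S ⟨(g, i, j), rfl⟩⟩
  have hM : ∀ g, (M g).map (algebraMap K L) = LinearMap.toMatrix b b (Y.ρ g) := by
    intro g
    ext i j
    rw [LinearMap.toMatrix_apply]
    rfl
  have hinj : Function.Injective fun A : Matrix (Fin n) (Fin n) K => A.map (algebraMap K L) :=
    Matrix.map_injective (algebraMap K L).injective
  let ρ : Representation K G (Fin n → K) :=
    { toFun g := Matrix.toLin' (M g)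
      map_one' := by
        have : M 1 = 1 := hinj (by
          dsimp only
          rw [hM, map_one, Matrix.map_one _ (map_zero _) (map_one _)]
          exact LinearMap.toMatrix_one b)
        rw [this, Matrix.toLin'_one]
        rfl
      map_mul' g h := by
        have : M (g * h) = M g * M h := hinj (by
          dsimp only
          rw [Matrix.map_mul, hM, hM, hM, map_mul, LinearMap.toMatrix_mul])
        rw [this, Matrix.toLin'_mul]
        rfl }
  let b' := (Pi.basisFun K (Fin n)).baseChange L
  let e := b'.equiv b (Equiv.refl _)
  refine ⟨K, hK, exists_indecomposable_of_equiv_baseChange Y ρ (Representation.Equiv.mk e ?_)⟩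
  intro g
  refine b'.ext fun j => ?_
  have h1 : e (b' j) = b j := b'.equiv_apply j b _
  have h2 : baseChange L ρ g (b' j) = ∑ i, (M g i j : L) • b' i := by
    have : ρ g (Pi.basisFun K (Fin n) j) = ∑ i, M g i j • Pi.basisFun K (Fin n) i := by
      change Matrix.toLin' (M g) _ = _
      ext i
      simp [Finset.sum_apply, Pi.single_apply]
    simp only [b', Module.Basis.baseChange_apply]
    change (1 : L) ⊗ₜ[K] (ρ g (Pi.basisFun K (Fin n) j)) = _
    rw [this, TensorProduct.tmul_sum]
    refine Finset.sum_congr rfl fun i _ => ?_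
    rw [TensorProduct.tmul_smul, TensorProduct.smul_tmul', TensorProduct.smul_tmul']
    rfl
  rw [LinearMap.comp_apply, LinearMap.comp_apply, h2]
  simp only [map_sum, map_smul, LinearEquiv.coe_coe]
  rw [h1]
  conv_rhs => rw [← b.sum_repr (Y.ρ g (b j))]
  refine Finset.sum_congr rfl fun i _ => ?_
  rw [show e (b' i) = b i from b'.equiv_apply i b _]

/-- Every nonzero module has an indecomposable summand. -/
theorem exists_indecomposable_isSummand {V : Type u} [AddCommGroup V] [Module F V]
    [FiniteDimensional F V] [Nontrivial V] (ρ : Representation F G V) :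
    ∃ B : IndecModule F G, IsSummand B.ρ ρ := by
  obtain ⟨B, i, r, hi, hr, hri, -⟩ := exists_indecomposable_summand ρ (fun x => x ≠ 0)
    (fun h => h rfl) (fun f g _ _ hfg => by
      by_contra! h
      exact hfg (by rw [h.1, h.2, add_zero]))
    (fun h => by
      obtain ⟨v, hv⟩ := exists_ne (0 : V)
      exact hv (LinearMap.congr_fun h v))
  exact ⟨B, isSummand_iff.mpr ⟨i, r, hi, hr, hri⟩⟩

/-- The part of Krull–Schmidt that is needed: when `ρ` is split, Fitting on `Y` shows that the
extension of one component still contains `Y`. -/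
theorem exists_isSummand_of_isSummand_baseChange (Y : IndecModule L G) {V : Type u}
    [AddCommGroup V] [Module F V] [FiniteDimensional F V] {ρ : Representation F G V}
    (h : IsSummand Y.ρ (baseChange L ρ)) :
    ∃ W : IndecModule F G, IsSummand Y.ρ (baseChange L W.ρ) := by
  have hY := Y.indecomposable
  have := hY.1
  obtain ⟨i', r', hi', hr', hri'⟩ := isSummand_iff.mp h
  have hint : ∀ {x : V →ₗ[F] V}, IsIntertwiningMap ρ ρ x → IsIntertwiningMap Y.ρ Y.ρ
      (r' ∘ₗ x.baseChange L ∘ₗ i') := fun hx =>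
    isIntertwiningMap_comp hr' (isIntertwiningMap_comp (isIntertwiningMap_baseChange hx) hi')
  obtain ⟨B, i, r, hi, hr, hri, hb⟩ := exists_indecomposable_summand ρ
    (fun x => Function.Bijective (r' ∘ₗ x.baseChange L ∘ₗ i'))
    (fun h0 => by
      rw [LinearMap.baseChange_zero, LinearMap.zero_comp, LinearMap.comp_zero] at h0
      obtain ⟨v, hv⟩ := exists_ne (0 : Y.carrier)
      exact hv (h0.1 rfl))
    (fun x y hx hy hxy => by
      rw [LinearMap.baseChange_add, LinearMap.add_comp, LinearMap.comp_add] at hxy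
      exact bijective_or_bijective_of_add hY (hint hx) (hint hy) hxy)
    (by
      rw [LinearMap.baseChange_id, LinearMap.id_comp, hri']
      exact Function.bijective_id)
  rw [LinearMap.baseChange_comp, LinearMap.comp_assoc, ← LinearMap.comp_assoc] at hb
  exact ⟨B, isSummand_of_bijective
    (isIntertwiningMap_comp (isIntertwiningMap_baseChange hr) hi')
    (isIntertwiningMap_comp hr' (isIntertwiningMap_baseChange hi)) hb⟩

/-- Every indecomposable module over an algebraic extension of a perfect field divides the scalar
extension of an indecomposable module. -/
theorem exists_isSummand_baseChange [PerfectField F] [Algebra.IsAlgebraic F L] [Finite G]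
    (Y : IndecModule L G) : ∃ W : IndecModule F G, IsSummand Y.ρ (baseChange L W.ρ) := by
  obtain ⟨K, hK, V, ⟨e⟩⟩ := exists_equiv_baseChange (F := F) Y
  let _ : Module F V.carrier := Module.compHom V.carrier (algebraMap F K)
  have : IsScalarTower F K V.carrier := IsScalarTower.of_algebraMap_smul fun _ _ => rfl
  have : FiniteDimensional F V.carrier := Module.Finite.trans K V.carrier
  have h1 := (isSummand_baseChange_restrictScalars (F := F) V.ρ).baseChange (L := L)
  exact exists_isSummand_of_isSummand_baseChange Y ((isSummand_of_equiv e.symm).trans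
    (h1.trans (isSummand_of_equiv (baseChangeBaseChange _))))

end Descent

/-! ### Vertices, sources and Green correspondents under scalar extension. -/

section Correspondence

variable {F : Type u} [Field F] {L : Type u} [Field L] [Algebra F L]
  {G : Type v} [Group G]

theorem nonempty_equiv_of_isSummand_baseChange {Y : IndecModule L G} {W W' : IndecModule F G}
    (h : IsSummand Y.ρ (baseChange L W.ρ)) (h' : IsSummand Y.ρ (baseChange L W'.ρ)) :
    Nonempty (W.ρ.Equiv W'.ρ) := by
  have := Y.indecomposable.1
  have := W.indecomposable.1
  exact W'.indecomposable.nonempty_equiv_of_isSummand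
    (isSummand_of_isSummand_baseChange W.indecomposable h h')

/-- Over `L` the modules `V` and K ⊗ W have the common summand `Y`, and this descends to `K`. -/
theorem up_of_equiv_baseChange {K : Type u} [Field K] [Algebra F K] [Algebra K L]
    [IsScalarTower F K L] {Y : IndecModule L G} {W : IndecModule F G} {V : IndecModule K G}
    (h : IsSummand Y.ρ (baseChange L W.ρ)) (e : (baseChange L V.ρ).Equiv Y.ρ) : Up W V := by
  have := Y.indecomposable.1
  exact isSummand_of_isSummand_baseChange V.indecomposable (isSummand_of_equiv e.symm)
    (h.trans (isSummand_of_equiv (baseChangeBaseChange W.ρ).symm))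

theorem Up.trans {K : Type u} [Field K] [Algebra F K] [Algebra K L]
    [IsScalarTower F K L] {Y : IndecModule L G} {W : IndecModule F G} {V : IndecModule K G}
    (h : Up W V) (h' : Up V Y) : Up W Y :=
  IsSummand.trans h'
    ((IsSummand.baseChange h).trans (isSummand_of_equiv (baseChangeBaseChange W.ρ)))

theorem Up.isVertex_iff [Finite G] {V : IndecModule F G} {Y : IndecModule L G} (h : Up V Y)
    {Q : Subgroup G} : IsVertex Q Y.ρ ↔ IsVertex Q V.ρ := by
  have := Y.indecomposable.1
  have key : ∀ R : Subgroup G, HasTrace R Y.ρ ↔ HasTrace R V.ρ := fun R =>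
    hasTrace_iff_of_isSummand_baseChange V.indecomposable h
  simp only [GreenTheory.isVertex_iff, key]

/-- Extending the maps in the trace criterion avoids identifying L ⊗ Ind S with Ind(L ⊗ S). -/
theorem IsSummand.ind_baseChange [Finite G] {Q : Subgroup G} {V : IndecModule F G}
    {S : IndecModule F Q} {Y : IndecModule L G} (h : IsSummand V.ρ (ind Q S.ρ)) (hY : Up V Y) :
    IsSummand Y.ρ (ind Q (GreenTheory.baseChange L S.ρ)) := by
  obtain ⟨a, b, ha, hb, hab⟩ := isSummand_ind_iff.mp h
  refine IsSummand.trans hY (isSummand_ind_iff.mpr ⟨a.baseChange L, b.baseChange L, ?_, ?_, ?_⟩)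
  · exact ⟨fun g v => (isIntertwiningMap_baseChange ha).isIntertwining g v⟩
  · exact ⟨fun g v => (isIntertwiningMap_baseChange hb).isIntertwining g v⟩
  · rw [← LinearMap.baseChange_comp, relTrace_baseChange, hab, LinearMap.baseChange_id]

theorem exists_isGreenCorrespondent [Finite G] {Q : Subgroup G} {V : IndecModule F G}
    (hV : IsVertex Q V.ρ) :
    ∃ B : IndecModule F (Subgroup.normalizer (Q : Set G)), IsGreenCorrespondent Q V B := by
  obtain ⟨B, h1, h2, -⟩ := exists_greenCorrespondent Subgroup.le_normalizer
    (fun _ => mem_normalizer_of_conj_mem) hV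
  exact ⟨B, hV, h1, h2⟩

theorem isSummand_greenCorrespondent [Finite G] {Q : Subgroup G} {V : IndecModule F G}
    {Y : IndecModule L G} (hY : Up V Y) {B : IndecModule F (Subgroup.normalizer (Q : Set G))}
    {A : IndecModule L (Subgroup.normalizer (Q : Set G))} (hB : IsGreenCorrespondent Q V B)
    (hA : IsGreenCorrespondent Q Y A) : IsSummand A.ρ (baseChange L B.ρ) := by
  have hH : ∀ g : G, (∀ x ∈ Q, g⁻¹ * x * g ∈ Q) → g ∈ Subgroup.normalizer (Q : Set G) :=
    fun _ => mem_normalizer_of_conj_mem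
  obtain ⟨B₀, h1, h2, a, b, ha, hb, hab⟩ :=
    exists_greenCorrespondent Subgroup.le_normalizer hH hB.1
  have hB₀ : HasTrace (Q.subgroupOf _) B₀.ρ := (isVertex_iff.mp h1).1
  -- Uniqueness of the Green correspondent: the given `B` is identified with the `B₀` that comes
  -- with trace data. The same argument, with these data extended to `L`, then handles `A`.
  have h3 : IsSummand B.ρ B₀.ρ := isSummand_of_isSummand_res Subgroup.le_normalizer hH hB₀ ha hb hab
    B.indecomposable hB.2.1 hB.2.2
  have := B.indecomposable.1
  obtain ⟨e⟩ := B₀.indecomposable.nonempty_equiv_of_isSummand h3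
  have h4 : IsSummand A.ρ (baseChange L B₀.ρ) := by
    refine isSummand_of_isSummand_res Subgroup.le_normalizer hH (υ := baseChange L V.ρ)
      (a := a.baseChange L) (b := b.baseChange L) hB₀.baseChange ?_ ?_ ?_ A.indecomposable hA.2.1 ?_
    · exact ⟨fun g v => (isIntertwiningMap_baseChange ha).isIntertwining g v⟩
    · exact ⟨fun g v => (isIntertwiningMap_baseChange hb).isIntertwining g v⟩
    · rw [← LinearMap.baseChange_comp, relTrace_baseChange, hab, LinearMap.baseChange_id]
    · obtain ⟨i, r, hi, hr, hri⟩ := isSummand_iff.mp hY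
      exact hA.2.2.trans (isSummand_iff.mpr
        ⟨i, r, isIntertwiningMap_res hi _, isIntertwiningMap_res hr _, hri⟩)
  exact h4.trans (isSummand_of_equiv e.symm).baseChange

end Correspondence

end GreenTheory

/-! ### The main theorem. -/

theorem mainTheorem3 (p : ℕ) (hp : p.Prime)
    (F : Type u) [Field F] (hF : Nat.card F = p)
    (Fbar : Type u) [Field Fbar] [Algebra F Fbar] [IsAlgClosure F Fbar]
    (G : Type v) [Group G] [Finite G] :
    ∃ Γ : GreenTheory.ITI Fbar G → GreenTheory.ITI F G,
      -- (a) `Γ` is given by the stated rule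
      (∀ (Y : GreenTheory.IndecModule Fbar G) (W : GreenTheory.IndecModule F G),
        Γ (GreenTheory.ITI.mk Y) = GreenTheory.ITI.mk W ↔
          ∃ x ∈ GreenTheory.E Fbar W,
            Nonempty ((GreenTheory.baseChange Fbar x.2.ρ).Equiv Y.ρ)) ∧
      -- (a) vertices, sources and Green correspondents
      (∀ (Y : GreenTheory.IndecModule Fbar G) (W : GreenTheory.IndecModule F G)
        (K : IntermediateField F Fbar) (V : GreenTheory.IndecModule K G) (Q : Subgroup G),
        Γ (GreenTheory.ITI.mk Y) = GreenTheory.ITI.mk W →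
        (⟨K, V⟩ : Σ K : IntermediateField F Fbar, GreenTheory.IndecModule K G) ∈
          GreenTheory.E Fbar W →
        Nonempty ((GreenTheory.baseChange Fbar V.ρ).Equiv Y.ρ) →
        GreenTheory.IsVertex Q W.ρ →
          GreenTheory.IsVertex Q V.ρ ∧
          GreenTheory.IsVertex Q Y.ρ ∧
          (∀ (SV : GreenTheory.IndecModule K Q) (SY : GreenTheory.IndecModule Fbar Q),
            GreenTheory.IsVertexSourcePair Q SV V →
            GreenTheory.IsVertexSourcePair Q SY Y →
              ∃ h : Subgroup.normalizer (Q : Set G),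
                GreenTheory.IsSummand (GreenTheory.conj Q h SY.ρ)
                  (GreenTheory.baseChange Fbar SV.ρ)) ∧
          (∃ B : GreenTheory.IndecModule K (Subgroup.normalizer (Q : Set G)),
            GreenTheory.IsGreenCorrespondent Q V B) ∧
          (∃ A : GreenTheory.IndecModule Fbar (Subgroup.normalizer (Q : Set G)),
            GreenTheory.IsGreenCorrespondent Q Y A) ∧
          (∀ (B : GreenTheory.IndecModule K (Subgroup.normalizer (Q : Set G)))
            (A : GreenTheory.IndecModule Fbar (Subgroup.normalizer (Q : Set G))),
            GreenTheory.IsGreenCorrespondent Q V B →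
            GreenTheory.IsGreenCorrespondent Q Y A →
              GreenTheory.IsSummand A.ρ (GreenTheory.baseChange Fbar B.ρ))) ∧
      -- (b) every fiber is nonempty
      (∀ W : GreenTheory.ITI F G, (Γ ⁻¹' {W}).Nonempty) ∧
      -- (c) the fibers partition `ITI(Fbar G)`
      ((⋃ W : GreenTheory.ITI F G, Γ ⁻¹' {W}) = Set.univ ∧
        ∀ W W' : GreenTheory.ITI F G, W ≠ W' → Disjoint (Γ ⁻¹' {W}) (Γ ⁻¹' {W'})) := by
  have hfin : Finite F := Nat.finite_of_card_ne_zero (hF ▸ hp.ne_zero)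
  have halg : Algebra.IsAlgebraic F Fbar := IsAlgClosure.isAlgebraic
  choose Γ₀ hΓ₀ using fun Y : GreenTheory.IndecModule Fbar G =>
    GreenTheory.exists_isSummand_baseChange (F := F) Y
  let Γ : GreenTheory.ITI Fbar G → GreenTheory.ITI F G :=
    Quotient.lift (fun Y => GreenTheory.ITI.mk (Γ₀ Y)) fun Y Y' ⟨e⟩ => Quotient.sound
      (GreenTheory.nonempty_equiv_of_isSummand_baseChange (hΓ₀ Y)
        ((GreenTheory.isSummand_of_equiv e).trans (hΓ₀ Y')))
  -- A description of Γ without intermediate fields, from which the rule through ℰ(W) and the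
  -- surjectivity both follow.
  have hΓ : ∀ (Y : GreenTheory.IndecModule Fbar G) (W : GreenTheory.IndecModule F G),
      Γ (GreenTheory.ITI.mk Y) = GreenTheory.ITI.mk W ↔ GreenTheory.Up W Y := by
    intro Y W
    constructor
    · intro h
      obtain ⟨e⟩ : Nonempty ((Γ₀ Y).ρ.Equiv W.ρ) := Quotient.exact h
      exact (hΓ₀ Y).trans (GreenTheory.isSummand_of_equiv e).baseChange
    · intro h
      exact Quotient.sound (GreenTheory.nonempty_equiv_of_isSummand_baseChange (hΓ₀ Y) h)
  refine ⟨Γ, ?_, ?_, ?_, ?_, ?_⟩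
  · intro Y W
    rw [hΓ]
    constructor
    · intro h
      obtain ⟨K, hK, V, ⟨e⟩⟩ := GreenTheory.exists_equiv_baseChange (F := F) Y
      exact ⟨⟨K, V⟩, ⟨Module.finite_of_finite F, GreenTheory.up_of_equiv_baseChange h e⟩, ⟨e⟩⟩
    · rintro ⟨⟨K, V⟩, ⟨-, hV⟩, ⟨e⟩⟩
      exact GreenTheory.Up.trans hV (GreenTheory.isSummand_of_equiv e.symm)
  · rintro Y W K V Q - ⟨-, hV⟩ ⟨e⟩ hQ
    have hVY : GreenTheory.Up V Y := GreenTheory.isSummand_of_equiv e.symm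
    have hQV : GreenTheory.IsVertex Q V.ρ := (GreenTheory.Up.isVertex_iff hV).mpr hQ
    have hQY : GreenTheory.IsVertex Q Y.ρ := hVY.isVertex_iff.mpr hQV
    refine ⟨hQV, hQY, fun SV SY hSV hSY => ?_, GreenTheory.exists_isGreenCorrespondent hQV,
      GreenTheory.exists_isGreenCorrespondent hQY,
      fun B A => GreenTheory.isSummand_greenCorrespondent hVY⟩
    exact GreenTheory.exists_isSummand_conj hQY hSY.2 (hSV.2.ind_baseChange hVY)
  · intro W
    induction W using Quotient.inductionOn with
    | h W =>
    have := W.indecomposable.1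
    obtain ⟨Y, hY⟩ :=
      GreenTheory.exists_indecomposable_isSummand (GreenTheory.baseChange Fbar W.ρ)
    exact ⟨GreenTheory.ITI.mk Y, (hΓ Y W).mpr hY⟩
  · exact Set.eq_univ_of_forall fun y => Set.mem_iUnion.mpr ⟨Γ y, rfl⟩
  · intro W W' h
    exact Set.disjoint_left.mpr fun y hy hy' => h (hy.symm.trans hy')
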